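/- Let $m$ be Lebesgue measure on the unit circle $\mathbb T$, normalized by $m(\mathbb T)=1$. For a finite positive measure $\rho$ on $\mathbb T$ put \[ e_n(\rho)=\min_{q_0,\dots,q_{n-1}\in\mathbb C}\Bigl(\int_{\mathbb T}\bigl|q_0+q_1t+\dots+q_{n-1}t^{n-1}+t^n\bigr|^2\,d\rho(t)\Bigr)^{1/2}. \] Let $h\colon(0,\tfrac12]\to[0,\infty)$ be a non-increasing function, and let $\rho$ be the measure that is absolutely continuous with respect to $m$ with density $e^{-h(|\theta|)}$ at the point $e^{2\pi i\theta}$, $-\tfrac12<\theta\le\tfrac12$. Let $0<\delta\le\tfrac12$. For a function $g>0$ on $(0,\delta]$, write $h\simeq g$ if there are constants $c,C>0$ with $c\,g(\theta)\le h(\theta)\le C\,g(\theta)$ for all $\theta\in(0,\delta]$ (for $\delta=\tfrac12$ this is comparability on the whole domain of $h$); for a sequence $r_n>0$, write $|\log e_n(\rho)|\simeq r_n$ if there are constants $k,K>0$ with $k\,r_n\le|\log e_n(\rho)|\le K\,r_n$ for all $n\ge4$. Then: 1. if $h(\theta)\simeq \dfrac1{\theta\log(1/\theta)}$, then $|\log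 e_n(\rho)|\simeq\log\log n$; 2. if $p>-1$ and $h(\theta)\simeq\theta^{-1}\log^p(1/\theta)$, then $|\log e_n(\rho)|\simeq(\log n)^{p+1}$; 3. if $p>1$ and $h(\theta)\simeq\theta^{-p}$, then $|\log e_n(\rho)|\simeq n^{(p-1)/(p+1)}$; 4. if $p>0$ and $h(\theta)\simeq\exp(\theta^{-p})$, then $|\log e_n(\rho)|\simeq n(\log n)^{-2/p}$. In each case the constants $k,K$ depend only on $c$, $C$, $\delta$ and (in 2-4) on $p$, and not otherwise on $h$. -/

import Mathlib

/-- The unit circle with its Borel σ-algebra. -/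
noncomputable instance Circle.instMeasurableSpaceBorel : MeasurableSpace Circle := borel Circle

instance Circle.instBorelSpaceBorel : BorelSpace Circle := ⟨rfl⟩

/-- The Lebesgue measure `m` on the unit circle, normalized by `m(𝕋) = 1`:
the image of Lebesgue measure on `(-1/2, 1/2]` under `θ ↦ e^{2πiθ}`. -/
noncomputable def circleMeasure : MeasureTheory.Measure Circle :=
  MeasureTheory.Measure.map (fun θ : ℝ => Circle.exp (2 * Real.pi * θ))
    (MeasureTheory.volume.restrict (Set.Ioc (-1 / 2 : ℝ) (1 / 2)))

/-- `e_n(ρ)`: the distance in `L²(ρ)` from `t^n` to the polynomials of degree at most `n - 1`,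
i.e. the smallest `L²(ρ)`-norm of a monic polynomial of degree `n`. -/
noncomputable def szegoError (ρ : MeasureTheory.Measure Circle) (n : ℕ) : ℝ :=
  ⨅ q : Fin n → ℂ,
    Real.sqrt (∫ t : Circle, ‖(∑ k : Fin n, q k * (t : ℂ) ^ (k : ℕ)) + (t : ℂ) ^ n‖ ^ 2 ∂ρ)

/-- The absolutely continuous measure on the unit circle whose density with respect to `m` at
`t = e^{2πiθ}`, `-1/2 < θ ≤ 1/2`, is `e^{-h(|θ|)}`; here `θ = arg t / (2π)`. -/
noncomputable def deepZeroMeasure (h : ℝ → ℝ) : MeasureTheory.Measure Circle :=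
  circleMeasure.withDensity
    (fun t => ENNReal.ofReal (Real.exp (-h |Complex.arg (t : ℂ) / (2 * Real.pi)|)))

/-- `c g ≤ f ≤ C g` on `S`. -/
def ComparableOn {α : Type*} (S : Set α) (c C : ℝ) (f g : α → ℝ) : Prop :=
  ∀ x ∈ S, c * g x ≤ f x ∧ f x ≤ C * g x

/-- "If `h ≃ g`, then `|log e_n| ≃ r n` for `n ≥ 4`", for the measure with density `e^{-h(|θ|)}`,
where `h` ranges over the nonnegative nonincreasing functions on `(0, 1/2]`.
The relation `h ≃ g` is required on some interval `(0, δ]` with `0 < δ ≤ 1/2` (the case `δ = 1/2`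
is the whole domain), and the constants of the conclusion depend only on those of the
hypothesis, not on `h` itself. -/
def HasDeepZeroRate (g : ℝ → ℝ) (r : ℕ → ℝ) : Prop :=
  ∀ c C δ : ℝ, 0 < c → 0 < C → 0 < δ → δ ≤ 1 / 2 →
    ∃ k K : ℝ, 0 < k ∧ 0 < K ∧
      ∀ h : ℝ → ℝ, AntitoneOn h (Set.Ioc 0 (1 / 2)) → (∀ θ ∈ Set.Ioc (0 : ℝ) (1 / 2), 0 ≤ h θ) →
        ComparableOn (Set.Ioc 0 δ) c C h g →
          ComparableOn (Set.Ici 4) k K (fun n => |Real.log (szegoError (deepZeroMeasure h) n)|) r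

/-! Everything rests on estimates of `|log e_n|` at a free scale `δ`.

Upper bound (`szegoError_pos_and_neg_log_le`): `|log e_n| ≤ 3 + δ h(δ) + 9 n δ² + ∫_δ^{1/2} h` for
every `δ ≤ 1/4`. By Jensen's inequality and the fact that a monic polynomial has Mahler measure at
least 1, `∫ |P|² e^u ≥ exp (∫ u)` for monic `P`. With `u = -h` this may be empty, since `h` need not
be integrable. So on `|θ| < δ` the weight is replaced by `|θ| e^{-B}`, and a Remez inequality
(`remez_arc`) shows that a polynomial of degree `n` cannot detect the change once `B = h(δ) + 9 (n +
1) δ`.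

Lower bounds come from explicit monic polynomials. If `h(δ) ≥ 10 n δ`, the Chebyshev polynomial of
the arc `|θ| ≥ δ` gives `|log e_n| ≥ 2 n δ² - 3` (`le_neg_log_szegoError_of_gap`). This matches the
upper bound when `h` grows faster than a power `θ^{-p}`, `p > 1`, or like one: `δ` is chosen so that
`h(δ)` and `n δ` balance, up to harmless factors. For `h` near `θ⁻¹` that choice has `n δ²` too
small to be useful, and `∫_δ h` with `δ = n^{-1/2}` dominates. There the test polynomial is `(1 +
W/N)^N`, a substitute for `e^W`, where `W` is a dyadic sum of analytic Fejér kernels with `2 Re W ≤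
h + O(1)`; its value at 0 is about `e^{W(0)}`, and reflection turns that value into a leading
coefficient (`le_neg_log_szegoError_of_fejer_sum`).

All bounds hold for large `n` up to additive constants; monotonicity of `e_n` and the test
polynomial 1 extend them to all `n ≥ 4`. -/

open MeasureTheory Polynomial Filter

/-! ### Integrals over the circle as integrals over `(-1/2, 1/2]`. -/

/-- The point `e^{2πiθ}` of the unit circle. -/
noncomputable def circlePoint (θ : ℝ) : ℂ := (Circle.exp (2 * Real.pi * θ) : ℂ)

lemma circlePoint_eq_exp (θ : ℝ) :
    circlePoint θ = Complex.exp ((2 * Real.pi * θ : ℝ) * Complex.I) := by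
  simp [circlePoint, Circle.coe_exp]

@[fun_prop]
lemma continuous_circlePoint : Continuous circlePoint := by
  unfold circlePoint; fun_prop

@[simp]
lemma norm_circlePoint (θ : ℝ) : ‖circlePoint θ‖ = 1 := by
  exact Circle.norm_coe _

/-- The energy `∫ |P|² dρ` of a polynomial with respect to the measure of density `e^{-h(|θ|)}`. -/
noncomputable def energy (h : ℝ → ℝ) (P : ℂ[X]) : ℝ :=
  ∫ θ in (-1 / 2 : ℝ)..(1 / 2), ‖P.eval (circlePoint θ)‖ ^ 2 * Real.exp (-h |θ|)

/-- Nonnegative nonincreasing functions on `(0, 1/2]`. -/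
structure IsDeepProfile (h : ℝ → ℝ) : Prop where
  anti : AntitoneOn h (Set.Ioc 0 (1 / 2))
  nonneg : ∀ θ ∈ Set.Ioc (0 : ℝ) (1 / 2), 0 ≤ h θ

/-- Measurability of the density comes from monotonicity, but `h` is arbitrary off `(0, 1/2]`;
extending `e^{-h}` by 0 on the left and 1 on the right gives a function monotone on the whole line.
-/
lemma IsDeepProfile.exists_monotone {h : ℝ → ℝ} (hh : IsDeepProfile h) :
    ∃ G : ℝ → ℝ, Monotone G ∧ (∀ x, 0 ≤ G x ∧ G x ≤ 1) ∧
      ∀ x ∈ Set.Ioc (0 : ℝ) (1 / 2), G x = Real.exp (-h x) := by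
  refine ⟨fun x => if x ≤ 0 then 0 else if x ≤ 1 / 2 then Real.exp (-h x) else 1, ?_, ?_, ?_⟩
  · intro x y hxy
    dsimp only
    split_ifs with h1 h2 h3 h4 h5 h6 h7 <;> try linarith
    · positivity
    · exact Real.exp_le_exp.2 (neg_le_neg (hh.anti ⟨by linarith, h4⟩ ⟨by linarith, by linarith⟩ hxy))
    · exact Real.exp_le_one_iff.2 (neg_nonpos.2 (hh.nonneg _ ⟨by linarith, by linarith⟩))
  · intro x
    dsimp only
    split_ifs with h1 h2
    · simp
    · exact ⟨(Real.exp_pos _).le,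
        Real.exp_le_one_iff.2 (neg_nonpos.2 (hh.nonneg _ ⟨by linarith, by linarith⟩))⟩
    · simp
  · intro x hx
    dsimp only
    rw [if_neg (not_le.2 hx.1), if_pos hx.2]

lemma IsDeepProfile.measurable_density {h : ℝ → ℝ} (hh : IsDeepProfile h) :
    Measurable (fun θ : ℝ => if |θ| ≤ 1 / 2 then Real.exp (-h |θ|) else 1) := by
  obtain ⟨G, hG, -, hG2⟩ := hh.exists_monotone
  have : (fun θ : ℝ => if |θ| ≤ 1 / 2 then Real.exp (-h |θ|) else 1) =
      fun θ : ℝ => if θ = 0 then Real.exp (-h 0) else if |θ| ≤ 1 / 2 then G |θ| else 1 := by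
    ext θ
    split_ifs with h1 h2 h3
    · simp [h2]
    · rw [hG2 _ ⟨abs_pos.2 h2, h1⟩]
    · subst h3; norm_num at h1
    · rfl
  rw [this]
  refine Measurable.ite (measurableSet_eq) measurable_const ?_
  refine Measurable.ite (measurableSet_le (by fun_prop) measurable_const) ?_ measurable_const
  exact hG.measurable.comp (by fun_prop)

lemma circle_continuous_coe : Continuous (fun t : Circle => (t : ℂ)) := by
  fun_prop

lemma abs_arg_div_le (z : ℂ) : |Complex.arg z / (2 * Real.pi)| ≤ 1 / 2 := by
  rw [abs_div, abs_of_pos Real.two_pi_pos, div_le_iff₀ Real.two_pi_pos]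
  linarith [Complex.abs_arg_le_pi z]

lemma arg_circle_exp_div {θ : ℝ} (hθ : θ ∈ Set.Ioc (-1 / 2 : ℝ) (1 / 2)) :
    Complex.arg (Circle.exp (2 * Real.pi * θ) : ℂ) / (2 * Real.pi) = θ := by
  have := Real.pi_pos
  rw [Circle.arg_exp (by nlinarith [hθ.1]) (by nlinarith [hθ.2])]
  field_simp

lemma IsDeepProfile.integral_deepZeroMeasure {h : ℝ → ℝ} (hh : IsDeepProfile h) {F : Circle → ℝ}
    (hF : Continuous F) :
    ∫ t, F t ∂(deepZeroMeasure h) =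
      ∫ θ in (-1 / 2 : ℝ)..(1 / 2), F (Circle.exp (2 * Real.pi * θ)) * Real.exp (-h |θ|) := by
  have hmeas : Measurable (fun t : Circle =>
      Real.exp (-h |Complex.arg (t : ℂ) / (2 * Real.pi)|)) := by
    have h1 := hh.measurable_density.comp
      ((Complex.measurable_arg.comp circle_continuous_coe.measurable).div_const (2 * Real.pi))
    convert h1 using 1
    ext t
    simp only [Function.comp_apply]
    rw [if_pos (abs_arg_div_le _)]
  unfold deepZeroMeasure
  rw [integral_withDensity_eq_integral_toReal_smul hmeas.ennreal_ofReal (by simp)]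
  unfold circleMeasure
  have hm2 : Measurable (fun t : Circle =>
      (ENNReal.ofReal (Real.exp (-h |Complex.arg (t : ℂ) / (2 * Real.pi)|))).toReal • F t) :=
    hmeas.ennreal_ofReal.ennreal_toReal.smul hF.measurable
  have hc : Measurable (fun θ : ℝ => Circle.exp (2 * Real.pi * θ)) :=
    (Circle.exp.continuous.comp (by fun_prop)).measurable
  refine (integral_map hc.aemeasurable hm2.aestronglyMeasurable).trans ?_
  rw [intervalIntegral.integral_of_le (by norm_num)]
  refine setIntegral_congr_fun measurableSet_Ioc fun θ hθ => ?_
  simp only [smul_eq_mul]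
  rw [arg_circle_exp_div hθ, ENNReal.toReal_ofReal (Real.exp_pos _).le, mul_comm]

lemma IsDeepProfile.intervalIntegrable_weight {h : ℝ → ℝ} (hh : IsDeepProfile h) {f : ℝ → ℝ}
    (hf : Continuous f) :
    IntervalIntegrable (fun θ => f θ * Real.exp (-h |θ|)) volume (-1 / 2) (1 / 2) := by
  rw [intervalIntegrable_iff_integrableOn_Ioc_of_le (by norm_num)]
  obtain ⟨B, hB⟩ := (isCompact_Icc (a := (-1 / 2 : ℝ)) (b := 1 / 2)).exists_bound_of_continuousOn
    hf.continuousOn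
  have h0 : IntegrableOn (fun θ => f θ * (if |θ| ≤ 1 / 2 then Real.exp (-h |θ|) else 1))
      (Set.Ioc (-1 / 2) (1 / 2)) := by
    -- The value `h 0` is unconstrained, so the density at `0` needs its own bound.
    refine Measure.integrableOn_of_bounded (M := B * max 1 (Real.exp (-h 0))) (by simp)
      (hf.measurable.mul hh.measurable_density).aestronglyMeasurable ?_
    refine (ae_restrict_iff' measurableSet_Ioc).2 (ae_of_all _ fun θ hθ => ?_)
    rw [norm_mul]
    have hB0 := hB θ ⟨hθ.1.le, hθ.2⟩
    refine mul_le_mul hB0 ?_ (norm_nonneg _) ((norm_nonneg _).trans hB0)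
    rw [if_pos (abs_le.2 ⟨by linarith [hθ.1], hθ.2⟩), Real.norm_of_nonneg (Real.exp_pos _).le]
    rcases eq_or_ne θ 0 with rfl | h
    · simp
    · refine le_max_of_le_left (Real.exp_le_one_iff.2 (neg_nonpos.2 (hh.nonneg _ ⟨abs_pos.2 h, ?_⟩)))
      exact abs_le.2 ⟨by linarith [hθ.1], hθ.2⟩
  refine h0.congr_fun (fun θ hθ => ?_) measurableSet_Ioc
  simp only
  rw [if_pos (abs_le.2 ⟨by linarith [hθ.1], hθ.2⟩)]

lemma IsDeepProfile.energy_integrable {h : ℝ → ℝ} (hh : IsDeepProfile h) (P : ℂ[X]) :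
    IntervalIntegrable (fun θ => ‖P.eval (circlePoint θ)‖ ^ 2 * Real.exp (-h |θ|))
      volume (-1 / 2) (1 / 2) :=
  hh.intervalIntegrable_weight (f := fun θ => ‖P.eval (circlePoint θ)‖ ^ 2) (by fun_prop)

lemma IsDeepProfile.integral_norm_sq_eval {h : ℝ → ℝ} (hh : IsDeepProfile h) (P : ℂ[X]) :
    ∫ t : Circle, ‖P.eval (t : ℂ)‖ ^ 2 ∂(deepZeroMeasure h) = energy h P :=
  hh.integral_deepZeroMeasure (F := fun t => ‖P.eval (t : ℂ)‖ ^ 2)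
    (((P.continuous.comp circle_continuous_coe).norm).pow 2)

/-! ### `e_n` as an infimum over monic polynomials, and its monotonicity in `n`. -/

lemma bddBelow_szego (ρ : Measure Circle) (n : ℕ) : BddBelow (Set.range fun q : Fin n → ℂ =>
    Real.sqrt (∫ t : Circle, ‖(∑ k : Fin n, q k * (t : ℂ) ^ (k : ℕ)) + (t : ℂ) ^ n‖ ^ 2 ∂ρ)) :=
  ⟨0, by rintro _ ⟨q, rfl⟩; exact Real.sqrt_nonneg _⟩

lemma IsDeepProfile.szegoError_le {h : ℝ → ℝ} (hh : IsDeepProfile h) {P : ℂ[X]} (hP : P.Monic) :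
    szegoError (deepZeroMeasure h) P.natDegree ≤ Real.sqrt (energy h P) := by
  refine (ciInf_le (bddBelow_szego _ _) (fun k => P.coeff k)).trans (le_of_eq ?_)
  rw [← hh.integral_norm_sq_eval]
  congr 2
  ext t
  rw [eval_eq_sum_range, Finset.sum_range_succ, hP.coeff_natDegree, one_mul,
    ← Fin.sum_univ_eq_sum_range (fun k => P.coeff k * (t : ℂ) ^ k)]

lemma IsDeepProfile.le_szegoError {h : ℝ → ℝ} (hh : IsDeepProfile h) {n : ℕ} {x : ℝ}
    (H : ∀ P : ℂ[X], P.Monic → P.natDegree = n → x ≤ Real.sqrt (energy h P)) :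
    x ≤ szegoError (deepZeroMeasure h) n := by
  refine le_ciInf fun q => ?_
  have hdeg : (∑ k : Fin n, C (q k) * X ^ (k : ℕ) : ℂ[X]).degree < (n : WithBot ℕ) :=
    degree_sum_fin_lt q
  have hm : (X ^ n + ∑ k : Fin n, C (q k) * X ^ (k : ℕ)).Monic := monic_X_pow_add hdeg
  have hd : (X ^ n + ∑ k : Fin n, C (q k) * X ^ (k : ℕ)).natDegree = n :=
    natDegree_eq_of_degree_eq_some (by
      rw [degree_add_eq_left_of_degree_lt (by simpa using hdeg), degree_X_pow])
  refine (H _ hm hd).trans (le_of_eq ?_)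
  rw [← hh.integral_norm_sq_eval]
  congr 2
  ext t
  simp [eval_finsetSum, add_comm]

lemma energy_X_pow_mul (h : ℝ → ℝ) (P : ℂ[X]) (k : ℕ) : energy h (X ^ k * P) = energy h P := by
  simp [energy]

/-- A factor `X ^ k` has modulus 1 on the circle, so monic polynomials of lower degree may also
serve as test functions. -/
lemma IsDeepProfile.szegoError_le_of_natDegree_le {h : ℝ → ℝ} (hh : IsDeepProfile h) {P : ℂ[X]}
    (hP : P.Monic) {n : ℕ} (hn : P.natDegree ≤ n) :
    szegoError (deepZeroMeasure h) n ≤ Real.sqrt (energy h P) := by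
  have h1 := hh.szegoError_le ((monic_X_pow (R := ℂ) (n - P.natDegree)).mul hP)
  rwa [(monic_X_pow _).natDegree_mul hP, natDegree_X_pow, Nat.sub_add_cancel hn,
    energy_X_pow_mul] at h1

lemma IsDeepProfile.szegoError_antitone {h : ℝ → ℝ} (hh : IsDeepProfile h) :
    Antitone (szegoError (deepZeroMeasure h)) := fun _ _ hmn =>
  hh.le_szegoError fun _ hP hd => hh.szegoError_le_of_natDegree_le hP (hd.trans_le hmn)

/-! ### Mahler measure and Jensen's inequality. -/

lemma circleMap_two_pi_mul (θ : ℝ) : circleMap 0 1 (2 * Real.pi * θ) = circlePoint θ := by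
  rw [circlePoint_eq_exp]; simp [circleMap]

lemma circlePoint_periodic : Function.Periodic circlePoint 1 := fun θ => by
  rw [← circleMap_two_pi_mul, ← circleMap_two_pi_mul, mul_add, mul_one, periodic_circleMap]

lemma intervalIntegrable_log_norm_eval (P : ℂ[X]) :
    IntervalIntegrable (fun θ => Real.log ‖P.eval (circlePoint θ)‖) volume (-1 / 2) (1 / 2) := by
  have h1 := (P.intervalIntegrable_mahlerMeasure).comp_mul_left (c := 2 * Real.pi)
  simp only [circleMap_two_pi_mul] at h1
  have hper : Function.Periodic (fun θ => Real.log ‖P.eval (circlePoint θ)‖) 1 := fun θ => by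
    simp only [circlePoint_periodic θ]
  refine hper.intervalIntegrable (t := 0) one_ne_zero ?_ _ _
  convert h1 using 1
  · simp
  · field_simp; simp

lemma integral_log_norm_eval_nonneg {P : ℂ[X]} (hP : P.Monic) :
    0 ≤ ∫ θ in (-1 / 2 : ℝ)..(1 / 2), Real.log ‖P.eval (circlePoint θ)‖ := by
  have h1 : 0 ≤ P.logMahlerMeasure := by
    rw [logMahlerMeasure_eq_log_MahlerMeasure]
    exact Real.log_nonneg (one_le_mahlerMeasure_of_one_le_norm_leadingCoeff (by simp [hP]))
  have hper : Function.Periodic (fun θ => Real.log ‖P.eval (circlePoint θ)‖) 1 := fun θ => by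
    simp only [circlePoint_periodic θ]
  have h2 := hper.intervalIntegral_add_eq (-1 / 2) 0
  norm_num at h2
  norm_num
  rw [h2]
  rw [logMahlerMeasure_def, Real.circleAverage_def] at h1
  have h3 := intervalIntegral.integral_comp_mul_left (a := 0) (b := 1)
    (fun x => Real.log ‖P.eval (circleMap 0 1 x)‖) (c := 2 * Real.pi) (by positivity)
  simp only [circleMap_two_pi_mul, mul_zero, mul_one] at h3
  rw [h3]
  exact h1

lemma ae_eval_circlePoint_ne_zero {P : ℂ[X]} (hP : P ≠ 0) :
    ∀ᵐ θ ∂(volume.restrict (Set.Ioc (-1 / 2 : ℝ) (1 / 2))), P.eval (circlePoint θ) ≠ 0 := by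
  rw [ae_restrict_iff' measurableSet_Ioc]
  have hfin : (P.roots.toFinset.image
      (fun z : ℂ => Complex.arg z / (2 * Real.pi)) : Set ℝ).Finite := Finset.finite_toSet _
  filter_upwards [hfin.countable.ae_notMem volume] with θ h1 h2 h3
  refine h1 (Finset.mem_coe.2 (Finset.mem_image.2 ⟨circlePoint θ, ?_, arg_circle_exp_div h2⟩))
  simpa [hP] using h3

/-- The easy half of Szegő's theorem: convexity of `exp` on a probability space, applied to `log
|P|² + u`, where the mean of `log |P|²` is nonnegative because `P` is monic. -/
lemma exp_integral_le_of_monic {P : ℂ[X]} (hP : P.Monic) {u : ℝ → ℝ}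
    (hu : IntervalIntegrable u volume (-1 / 2) (1 / 2))
    (hPu : IntervalIntegrable (fun θ => ‖P.eval (circlePoint θ)‖ ^ 2 * Real.exp (u θ))
      volume (-1 / 2) (1 / 2)) :
    Real.exp (∫ θ in (-1 / 2 : ℝ)..(1 / 2), u θ) ≤
      ∫ θ in (-1 / 2 : ℝ)..(1 / 2), ‖P.eval (circlePoint θ)‖ ^ 2 * Real.exp (u θ) := by
  have hle : (-1 / 2 : ℝ) ≤ 1 / 2 := by norm_num
  have hL := (intervalIntegrable_log_norm_eval P).const_mul 2
  have hprob : IsProbabilityMeasure (volume.restrict (Set.Ioc (-1 / 2 : ℝ) (1 / 2))) :=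
    ⟨by rw [Measure.restrict_apply_univ, Real.volume_Ioc]; norm_num⟩
  have hf := hL.add hu
  have hae : ∀ᵐ θ ∂(volume.restrict (Set.Ioc (-1 / 2 : ℝ) (1 / 2))),
      ‖P.eval (circlePoint θ)‖ ^ 2 * Real.exp (u θ) =
        Real.exp (2 * Real.log ‖P.eval (circlePoint θ)‖ + u θ) := by
    filter_upwards [ae_eval_circlePoint_ne_zero hP.ne_zero] with θ hθ
    rw [Real.exp_add, two_mul, Real.exp_add, Real.exp_log (norm_pos_iff.2 hθ), sq]
  have h1 := convexOn_exp.map_integral_le (μ := volume.restrict (Set.Ioc (-1 / 2 : ℝ) (1 / 2)))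
    (f := fun θ => 2 * Real.log ‖P.eval (circlePoint θ)‖ + u θ) Real.continuous_exp.continuousOn
    isClosed_univ (ae_of_all _ fun _ => Set.mem_univ _) hf.1 (hPu.1.congr hae)
  rw [← integral_congr_ae hae, ← intervalIntegral.integral_of_le hle,
    ← intervalIntegral.integral_of_le hle, intervalIntegral.integral_add hL hu,
    intervalIntegral.integral_const_mul] at h1
  refine (Real.exp_le_exp.2 ?_).trans h1
  linarith [integral_log_norm_eval_nonneg hP]

/-! ### Growth of Chebyshev polynomials outside `[-1, 1]`. -/

lemma one_add_sq_div_two_le_cosh {s : ℝ} : 1 + s ^ 2 / 2 ≤ Real.cosh s := by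
  wlog hs : 0 ≤ s generalizing s
  · have := this (s := -s) (by linarith)
    simpa using this
  have h1 : s / 2 ≤ Real.sinh (s / 2) := Real.self_le_sinh_iff.2 (by linarith)
  have h2 : Real.cosh s = 2 * Real.sinh (s / 2) ^ 2 + 1 := by
    have := Real.cosh_two_mul (s / 2)
    rw [Real.cosh_sq] at this
    rw [show 2 * (s / 2) = s by ring] at this
    linarith
  nlinarith

/-- Writing `x = cosh a`, the value is `cosh (n a) ≤ e^{n a}`, and `1 + s²/2 ≤ cosh s` forces `a ≤
s`. -/
lemma chebyshev_T_le_exp {x s : ℝ} (hs : 0 ≤ s) (hx : 1 ≤ x) (hxs : x ≤ 1 + s ^ 2 / 2) (n : ℕ) :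
    |(Chebyshev.T ℝ n).eval x| ≤ Real.exp (n * s) := by
  have h1 : Real.cosh (Real.arcosh x) = x := Real.cosh_arcosh hx
  have h0 := Real.arcosh_nonneg hx
  have h2 : Real.arcosh x ≤ s := by
    have : Real.cosh (Real.arcosh x) ≤ Real.cosh s := by
      rw [h1]; exact hxs.trans one_add_sq_div_two_le_cosh
    rw [Real.cosh_le_cosh, abs_of_nonneg h0, abs_of_nonneg hs] at this
    exact this
  rw [← h1, Chebyshev.T_real_cosh, abs_of_pos (Real.cosh_pos _)]
  have h3 : (0 : ℝ) ≤ ((n : ℤ) : ℝ) * Real.arcosh x := mul_nonneg (by simp) h0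
  calc Real.cosh (((n : ℤ) : ℝ) * Real.arcosh x)
      ≤ Real.exp (((n : ℤ) : ℝ) * Real.arcosh x) := by
        have := Real.cosh_add_sinh (((n : ℤ) : ℝ) * Real.arcosh x)
        linarith [Real.sinh_nonneg_iff.2 h3]
    _ ≤ _ := Real.exp_le_exp.2 (by
        push_cast; exact mul_le_mul_of_nonneg_left h2 (Nat.cast_nonneg _))

lemma abs_eval_chebyshev_T_le_one {x : ℝ} (h1 : -1 ≤ x) (h2 : x ≤ 1) (n : ℕ) :
    |(Chebyshev.T ℝ n).eval x| ≤ 1 := by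
  rw [← Real.cos_arccos h1 h2, Chebyshev.T_real_cos]
  exact Real.abs_cos_le_one _

/-- Polynomials of degree `n` grow outside of `[-1, 1]` at most as fast as Chebyshev polynomials. -/
lemma eval_le_of_abs_le {A : ℝ[X]} {n : ℕ} (hA : A.degree ≤ n) {M : ℝ}
    (hM : ∀ x ∈ Set.Icc (-1 : ℝ) 1, |A.eval x| ≤ M) {x s : ℝ} (hs : 0 ≤ s) (hx : 1 ≤ x)
    (hxs : x ≤ 1 + s ^ 2 / 2) : A.eval x ≤ M * Real.exp (n * s) := by
  have hM0 : 0 ≤ M := (abs_nonneg _).trans (hM 0 (by simp))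
  refine le_of_forall_pos_le_add fun ε hε => ?_
  -- `M` may vanish, so `A` is normalized by a slightly larger constant; after multiplication by the
  -- growth factor the excess is exactly `ε`.
  set M' := M + ε / Real.exp (n * s)
  have hM' : 0 < M' := by positivity
  have h1 := Chebyshev.eval_iterate_derivative_le_of_forall_abs_le_one (n := n) (P := C M'⁻¹ * A)
    (k := 0) hx ((degree_C_mul (inv_ne_zero hM'.ne')).trans_le hA) (fun y hy => by
      rw [eval_mul, eval_C, abs_mul, abs_of_pos (inv_pos.2 hM')]
      rw [inv_mul_le_one₀ hM']
      exact (hM y hy).trans (by simp only [M']; linarith [div_pos hε (Real.exp_pos (n * s))]))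
  simp only [Function.iterate_zero, id, eval_mul, eval_C] at h1
  rw [inv_mul_le_iff₀ hM'] at h1
  refine h1.trans ((mul_le_mul_of_nonneg_left
    ((le_abs_self _).trans (chebyshev_T_le_exp hs hx hxs n)) hM'.le).trans (le_of_eq ?_))
  simp only [M']
  field_simp

/-! ### Symmetrization and a Remez inequality on arcs. -/

lemma circlePoint_neg (θ : ℝ) : circlePoint (-θ) = (starRingEnd ℂ) (circlePoint θ) := by
  rw [circlePoint_eq_exp, circlePoint_eq_exp, ← Complex.exp_conj,
    map_mul, Complex.conj_ofReal, Complex.conj_I]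
  congr 1
  push_cast
  ring

lemma circlePoint_pow (θ : ℝ) (k : ℕ) : circlePoint θ ^ k = circlePoint (k * θ) := by
  rw [circlePoint_eq_exp, circlePoint_eq_exp, ← Complex.exp_nat_mul]
  congr 1
  push_cast
  ring

lemma circlePoint_add (a b : ℝ) : circlePoint (a + b) = circlePoint a * circlePoint b := by
  rw [circlePoint_eq_exp, circlePoint_eq_exp, circlePoint_eq_exp, ← Complex.exp_add]
  congr 1
  push_cast
  ring

lemma circlePoint_re (θ : ℝ) : (circlePoint θ).re = Real.cos (2 * Real.pi * θ) := by
  rw [circlePoint_eq_exp, Complex.exp_ofReal_mul_I_re]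

/-- The symmetrization `|P(e^{2πiθ})|² + |P(e^{-2πiθ})|²`. -/
noncomputable def symmSq (P : ℂ[X]) (θ : ℝ) : ℝ :=
  ‖P.eval (circlePoint θ)‖ ^ 2 + ‖P.eval (circlePoint (-θ))‖ ^ 2

lemma symmSq_nonneg (P : ℂ[X]) (θ : ℝ) : 0 ≤ symmSq P θ := by unfold symmSq; positivity

@[fun_prop]
lemma continuous_symmSq (P : ℂ[X]) : Continuous (symmSq P) := by unfold symmSq; fun_prop

lemma norm_sq_eval_circlePoint (P : ℂ[X]) (θ : ℝ) :
    ‖P.eval (circlePoint θ)‖ ^ 2 = ∑ i ∈ Finset.range (P.natDegree + 1),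
      ∑ j ∈ Finset.range (P.natDegree + 1),
        (P.coeff i * (starRingEnd ℂ) (P.coeff j) * circlePoint (((i : ℤ) - (j : ℤ) : ℤ) * θ)).re := by
  rw [← Complex.normSq_eq_norm_sq]
  have : (Complex.normSq (P.eval (circlePoint θ)) : ℂ) =
      ∑ i ∈ Finset.range (P.natDegree + 1), ∑ j ∈ Finset.range (P.natDegree + 1),
        P.coeff i * (starRingEnd ℂ) (P.coeff j) * circlePoint (((i : ℤ) - (j : ℤ) : ℤ) * θ) := by
    rw [← Complex.mul_conj, eval_eq_sum_range, map_sum, Finset.sum_mul_sum]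
    refine Finset.sum_congr rfl fun i _ => Finset.sum_congr rfl fun j _ => ?_
    rw [map_mul, circlePoint_pow, circlePoint_pow, ← circlePoint_neg, mul_mul_mul_comm,
      ← circlePoint_add]
    congr 2
    push_cast
    ring
  rw [← Complex.ofReal_re (Complex.normSq _), this, Complex.re_sum]
  simp_rw [Complex.re_sum]

/-- The symmetrization of `|P|²` is a polynomial of degree at most `n` in `cos 2πθ`. -/
lemma exists_symmSq_eq_eval_cos (P : ℂ[X]) : ∃ R : ℝ[X], R.natDegree ≤ P.natDegree ∧
    ∀ θ, symmSq P θ = R.eval (Real.cos (2 * Real.pi * θ)) := by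
  refine ⟨∑ i ∈ Finset.range (P.natDegree + 1), ∑ j ∈ Finset.range (P.natDegree + 1),
    C (2 * (P.coeff i * (starRingEnd ℂ) (P.coeff j)).re) *
      Chebyshev.T ℝ ((i : ℤ) - (j : ℤ)), ?_, fun θ => ?_⟩
  · refine natDegree_sum_le_of_forall_le _ _ fun i hi => natDegree_sum_le_of_forall_le _ _
      fun j hj => (natDegree_C_mul_le _ _).trans ?_
    rw [Chebyshev.natDegree_T]
    simp only [Finset.mem_range] at hi hj
    omega
  · rw [symmSq, norm_sq_eval_circlePoint, norm_sq_eval_circlePoint, ← Finset.sum_add_distrib,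
      eval_finsetSum]
    refine Finset.sum_congr rfl fun i _ => ?_
    rw [← Finset.sum_add_distrib, eval_finsetSum]
    refine Finset.sum_congr rfl fun j _ => ?_
    rw [eval_mul, eval_C, Chebyshev.T_real_cos, mul_neg, circlePoint_neg,
      show (((i : ℤ) - (j : ℤ) : ℤ) : ℝ) * (2 * Real.pi * θ) =
        2 * Real.pi * ((((i : ℤ) - (j : ℤ) : ℤ) : ℝ) * θ) by ring, ← circlePoint_re]
    simp only [Complex.mul_re, Complex.conj_re, Complex.conj_im]
    ring

lemma exists_derivative_eq (R : ℝ[X]) (x₀ : ℝ) :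
    ∃ A : ℝ[X], derivative A = R ∧ A.natDegree ≤ R.natDegree + 1 ∧ A.eval x₀ = 0 := by
  set B : ℝ[X] := ∑ i ∈ Finset.range (R.natDegree + 1), C (R.coeff i / (i + 1)) * X ^ (i + 1)
  have hB : derivative B = R := by
    conv_rhs => rw [R.as_sum_range_C_mul_X_pow]
    simp only [B, derivative_sum, derivative_C_mul_X_pow]
    refine Finset.sum_congr rfl fun i _ => ?_
    push_cast
    rw [div_mul_cancel₀ _ (by positivity)]
  refine ⟨B - C (B.eval x₀), by simp [hB], ?_, by simp⟩
  rw [natDegree_sub_C]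
  refine natDegree_sum_le_of_forall_le _ _ fun i hi => (natDegree_C_mul_X_pow_le _ _).trans ?_
  simp only [Finset.mem_range] at hi
  omega

/-- The substitution `x = cos 2πθ`: masses of the symmetrized `|P|²`, weighted by the sine Jacobian,
become increments of the single polynomial `A`, to which pointwise growth bounds apply. -/
lemma integral_symmSq_mul_sin {P : ℂ[X]} {R A : ℝ[X]} (hA : derivative A = R)
    (hR : ∀ θ, symmSq P θ = R.eval (Real.cos (2 * Real.pi * θ))) (a b : ℝ) :
    ∫ θ in a..b, symmSq P θ * (2 * Real.pi * Real.sin (2 * Real.pi * θ)) =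
      A.eval (Real.cos (2 * Real.pi * a)) - A.eval (Real.cos (2 * Real.pi * b)) := by
  rw [intervalIntegral.integral_eq_sub_of_hasDerivAt
    (f := fun θ => -A.eval (Real.cos (2 * Real.pi * θ)))]
  · ring
  · intro θ _
    have h1 : HasDerivAt (fun θ : ℝ => 2 * Real.pi * θ) (2 * Real.pi) θ := by
      simpa using (hasDerivAt_id θ).const_mul (2 * Real.pi)
    have h2 := ((A.hasDerivAt (Real.cos (2 * Real.pi * θ))).comp θ h1.cos).neg
    refine h2.congr_deriv ?_
    rw [hR, hA]
    ring
  · exact Continuous.intervalIntegrable (by fun_prop) _ _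

/-- With `c = cos² πδ`, the arc `|θ| ≥ δ` becomes `x ∈ [-1, 2c - 1]`. The affine map `x ↦ (x + 1)/c
- 1` sends this to `[-1, 1]` and the point `x = 1` to `2/c - 1 = 1 + 2 tan² πδ`. As `c ≥ 1/2`, the
excess is at most `4π² δ²`, and `9²/2 > 4π²` explains the 9. -/
lemma cos_sq_arc {δ : ℝ} (hδ : 0 < δ) (hδ' : δ ≤ 1 / 4) :
    Real.cos (2 * Real.pi * δ) = 2 * Real.cos (Real.pi * δ) ^ 2 - 1 ∧
    1 / 2 ≤ Real.cos (Real.pi * δ) ^ 2 ∧ Real.cos (Real.pi * δ) ^ 2 ≤ 1 - 4 * δ ^ 2 ∧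
    2 / Real.cos (Real.pi * δ) ^ 2 - 1 ≤ 1 + (9 * δ) ^ 2 / 2 := by
  have hpi := Real.pi_pos
  have hpi4 : Real.pi ≤ 3.15 := Real.pi_lt_d2.le
  have hcos2 : Real.cos (2 * Real.pi * δ) = 2 * Real.cos (Real.pi * δ) ^ 2 - 1 := by
    rw [mul_assoc, Real.cos_two_mul]
  have hs0 : 0 ≤ Real.sin (Real.pi * δ) :=
    Real.sin_nonneg_of_nonneg_of_le_pi (by positivity) (by nlinarith)
  have hsin : Real.sin (Real.pi * δ) ^ 2 ≤ (Real.pi * δ) ^ 2 :=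
    pow_le_pow_left₀ hs0 (Real.sin_le (by positivity)) 2
  have hsin' : (2 * δ) ^ 2 ≤ Real.sin (Real.pi * δ) ^ 2 := by
    have := Real.mul_le_sin (x := Real.pi * δ) (by positivity) (by nlinarith)
    have e : 2 / Real.pi * (Real.pi * δ) = 2 * δ := by field_simp
    rw [e] at this
    exact pow_le_pow_left₀ (by positivity) this 2
  have hc2 : 1 / 2 ≤ Real.cos (Real.pi * δ) ^ 2 := by
    have h0 : 0 ≤ Real.cos (2 * Real.pi * δ) :=
      Real.cos_nonneg_of_neg_pi_div_two_le_of_le (by nlinarith) (by nlinarith)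
    linarith
  have hsc := Real.sin_sq_add_cos_sq (Real.pi * δ)
  refine ⟨hcos2, hc2, by linarith, ?_⟩
  set c := Real.cos (Real.pi * δ) ^ 2
  have : 2 / c - 1 = 1 + 2 * ((1 - c) / c) := by field_simp; ring
  rw [this]
  have h3 : (1 - c) / c ≤ 2 * (Real.pi * δ) ^ 2 := by
    rw [div_le_iff₀ (by linarith)]
    nlinarith [sq_nonneg (Real.pi * δ)]
  have h4 : Real.pi ^ 2 ≤ 9.9225 := by nlinarith
  nlinarith [mul_le_mul_of_nonneg_right h4 (sq_nonneg δ)]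

/-- A Remez type inequality for polynomials on the circle: the mass of `|P|²` near the point `1`
is controlled by its mass away from it. -/
lemma remez_arc (P : ℂ[X]) {δ : ℝ} (hδ : 0 < δ) (hδ' : δ ≤ 1 / 4) :
    ∫ θ in (0 : ℝ)..δ, symmSq P θ * θ ≤
      Real.exp ((P.natDegree + 1) * (9 * δ)) * ∫ θ in δ..(1 / 2), symmSq P θ := by
  obtain ⟨R, hRd, hR⟩ := exists_symmSq_eq_eval_cos P
  -- The primitive is taken from `-1`, the image of `θ = 1/2`. Since `R ≥ 0` on `[-1, 1]`, it is
  -- nonnegative and increasing there, so an integral bound on the far arc is a sup bound for `A`.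
  obtain ⟨A, hA, hAd, hA0⟩ := exists_derivative_eq R (-1)
  have hpi := Real.pi_pos
  have hRnn : ∀ x ∈ Set.Icc (-1 : ℝ) 1, 0 ≤ R.eval x := fun x hx => by
    have := hR (Real.arccos x / (2 * Real.pi))
    rw [mul_div_cancel₀ _ (by positivity), Real.cos_arccos hx.1 hx.2] at this
    rw [← this]; exact symmSq_nonneg _ _
  have hmono : MonotoneOn (fun x => A.eval x) (Set.Icc (-1 : ℝ) 1) := by
    refine monotoneOn_of_deriv_nonneg (convex_Icc _ _) A.continuous.continuousOn
      A.differentiable.differentiableOn fun x hx => ?_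
    rw [interior_Icc] at hx
    rw [A.deriv, hA]
    exact hRnn x ⟨hx.1.le, hx.2.le⟩
  obtain ⟨hcos2, hc2, hc1, hgr⟩ := cos_sq_arc hδ hδ'
  set c := Real.cos (Real.pi * δ) ^ 2
  replace hc1 : c ≤ 1 := by nlinarith [sq_nonneg δ]
  set I := ∫ θ in δ..(1 / 2), symmSq P θ with hI
  have hb : A.eval (2 * c - 1) ≤ 2 * Real.pi * I := by
    have h1 := integral_symmSq_mul_sin hA hR δ (1 / 2)
    rw [hcos2, show 2 * Real.pi * (1 / 2) = Real.pi by ring, Real.cos_pi, hA0, sub_zero] at h1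
    rw [← h1, hI, ← intervalIntegral.integral_const_mul]
    refine intervalIntegral.integral_mono_on (by linarith)
      (Continuous.intervalIntegrable (by fun_prop) _ _)
      (Continuous.intervalIntegrable (by fun_prop) _ _) fun θ _ => ?_
    have := mul_le_mul_of_nonneg_left (Real.sin_le_one (2 * Real.pi * θ))
      (mul_nonneg (symmSq_nonneg P θ) Real.two_pi_pos.le)
    linarith
  have hbd : ∀ x ∈ Set.Icc (-1 : ℝ) 1,
      |(A.comp (C c * (X + 1) - 1)).eval x| ≤ 2 * Real.pi * I := by
    intro x hx
    have e : (A.comp (C c * (X + 1) - 1)).eval x = A.eval (c * (x + 1) - 1) := by simp [eval_comp]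
    have hm : c * (x + 1) - 1 ∈ Set.Icc (-1 : ℝ) 1 := ⟨by nlinarith [hx.1], by nlinarith [hx.2]⟩
    have h0 : 0 ≤ A.eval (c * (x + 1) - 1) := by
      rw [← hA0]; exact hmono (by simp) hm hm.1
    rw [e, abs_of_nonneg h0]
    refine (hmono hm ⟨by linarith, by linarith⟩ ?_).trans hb
    nlinarith [hx.2]
  have hdeg : (A.comp (C c * (X + 1) - 1)).degree ≤ ((P.natDegree + 1 : ℕ) : WithBot ℕ) := by
    refine degree_le_of_natDegree_le (natDegree_comp_le.trans ?_)
    have : (C c * (X + 1) - 1 : ℝ[X]).natDegree ≤ 1 := by compute_degree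
    calc A.natDegree * (C c * (X + 1) - 1 : ℝ[X]).natDegree ≤ A.natDegree * 1 :=
          Nat.mul_le_mul_left _ this
      _ ≤ _ := by omega
  -- `2 / c - 1` is the point that the rescaling sends to `x = 1`, that is `θ = 0`.
  have hgrow := eval_le_of_abs_le hdeg hbd (x := 2 / c - 1) (s := 9 * δ) (by positivity)
    (by rw [le_sub_iff_add_le, le_div_iff₀ (by linarith)]; linarith) hgr
  have e1 : (A.comp (C c * (X + 1) - 1)).eval (2 / c - 1) = A.eval 1 := by
    have : c * (2 / c - 1 + 1) - 1 = 1 := by field_simp; ring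
    simp only [eval_comp, eval_sub, eval_mul, eval_C, eval_add, eval_X, eval_one, this]
  rw [e1] at hgrow
  have h5 := integral_symmSq_mul_sin hA hR 0 δ
  have hb0 : 0 ≤ A.eval (2 * c - 1) := by
    rw [← hA0]; exact hmono (by simp) ⟨by linarith, by linarith⟩ (by linarith)
  rw [mul_zero, Real.cos_zero, hcos2] at h5
  have h6 : 2 * Real.pi * ∫ θ in (0 : ℝ)..δ, symmSq P θ * θ ≤
      ∫ θ in (0 : ℝ)..δ, symmSq P θ * (2 * Real.pi * Real.sin (2 * Real.pi * θ)) := by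
    rw [← intervalIntegral.integral_const_mul]
    refine intervalIntegral.integral_mono_on hδ.le
      (Continuous.intervalIntegrable (by fun_prop) _ _)
      (Continuous.intervalIntegrable (by fun_prop) _ _) fun θ hθ => ?_
    -- The Jacobian vanishes at `θ = 0`; this is why the left side of the inequality carries the
    -- weight `θ`.
    have h7 : θ ≤ Real.sin (2 * Real.pi * θ) := by
      have := Real.mul_le_sin (x := 2 * Real.pi * θ) (by have := hθ.1; positivity)
        (by nlinarith [hθ.2])
      have e : 2 / Real.pi * (2 * Real.pi * θ) = 4 * θ := by field_simp; ring
      rw [e] at this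
      linarith [hθ.1]
    have := mul_le_mul_of_nonneg_left h7 (mul_nonneg (symmSq_nonneg P θ) Real.two_pi_pos.le)
    linarith
  have h8 : 2 * Real.pi * ∫ θ in (0 : ℝ)..δ, symmSq P θ * θ ≤
      2 * Real.pi * (Real.exp ((P.natDegree + 1) * (9 * δ)) * I) := by
    refine h6.trans ?_
    rw [h5]
    push_cast at hgrow
    linarith
  exact le_of_mul_le_mul_left h8 Real.two_pi_pos

/-! ### Upper bound for `|log e_n|` through a modified weight. -/

lemma integral_symm_eq {f : ℝ → ℝ} {a : ℝ} (ha : 0 ≤ a) (hf : IntervalIntegrable f volume (-a) a) :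
    ∫ θ in (-a)..a, f θ = ∫ θ in (0 : ℝ)..a, (f θ + f (-θ)) := by
  have h0 : (0 : ℝ) ∈ Set.uIcc (-a) a := by
    rw [Set.uIcc_of_le (by linarith)]; exact ⟨by linarith, ha⟩
  have h1 : IntervalIntegrable f volume (-a) 0 :=
    hf.mono_set (Set.uIcc_subset_uIcc Set.left_mem_uIcc h0)
  have h2 : IntervalIntegrable f volume 0 a :=
    hf.mono_set (Set.uIcc_subset_uIcc h0 Set.right_mem_uIcc)
  have h3 : IntervalIntegrable (fun θ => f (-θ)) volume 0 a := by
    have := h1.comp_mul_left (c := -1)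
    simp only [neg_mul, one_mul] at this
    simpa using this.symm
  rw [← intervalIntegral.integral_add_adjacent_intervals h1 h2,
    intervalIntegral.integral_add h2 h3, intervalIntegral.integral_comp_neg, neg_zero, add_comm]

lemma IsDeepProfile.intervalIntegrable {h : ℝ → ℝ} (hh : IsDeepProfile h) {δ : ℝ} (hδ : 0 < δ)
    (hδ' : δ ≤ 1 / 2) : IntervalIntegrable h volume δ (1 / 2) := by
  refine AntitoneOn.intervalIntegrable (hh.anti.mono ?_)
  rw [Set.uIcc_of_le hδ']
  exact fun x hx => ⟨hδ.trans_le hx.1, hx.2⟩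

/-- The logarithm of the modified weight: near `1` the weight `e^{-h}` is replaced by a
larger one, which still has a controlled effect on polynomials. -/
noncomputable def logWeight (h : ℝ → ℝ) (δ B θ : ℝ) : ℝ :=
  if |θ| < δ then Real.log |θ| - B else -h |θ|

lemma logWeight_neg (h : ℝ → ℝ) (δ B θ : ℝ) : logWeight h δ B (-θ) = logWeight h δ B θ := by
  simp [logWeight]

/-- The factor `|θ|` matches the weight in `remez_arc`, and costs little because `log |θ|` is
integrable at 0. -/
lemma logWeight_integrable_integral {h : ℝ → ℝ} (hh : IsDeepProfile h) {δ B : ℝ} (hδ : 0 < δ)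
    (hδ' : δ ≤ 1 / 4) :
    IntervalIntegrable (logWeight h δ B) volume (-1 / 2) (1 / 2) ∧
    ∫ θ in (-1 / 2 : ℝ)..(1 / 2), logWeight h δ B θ =
      2 * (δ * Real.log δ - δ - δ * B - ∫ θ in δ..(1 / 2), h θ) := by
  have hi := hh.intervalIntegrable hδ (by linarith)
  have hlog : IntervalIntegrable (fun θ => Real.log θ - B) volume 0 δ :=
    intervalIntegral.intervalIntegrable_log'.sub (by simp)
  have c1 : Set.EqOn (fun θ => Real.log θ - B) (logWeight h δ B) (Set.Ioo 0 δ) := fun θ hθ => by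
    simp [logWeight, abs_of_pos hθ.1, hθ.2]
  have c2 : Set.EqOn (fun θ => -h θ) (logWeight h δ B) (Set.uIcc δ (1 / 2)) := fun θ hθ => by
    rw [Set.uIcc_of_le (by linarith)] at hθ
    have : 0 < θ := hδ.trans_le hθ.1
    simp [logWeight, abs_of_pos this, not_lt.2 hθ.1]
  have a1 : (fun θ => Real.log θ - B) =ᵐ[volume.restrict (Set.uIoc 0 δ)] logWeight h δ B := by
    rw [Set.uIoc_of_le hδ.le, ← restrict_Ioo_eq_restrict_Ioc]
    exact (ae_restrict_iff' measurableSet_Ioo).2 (ae_of_all _ fun θ hθ => c1 hθ)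
  have i1 : IntervalIntegrable (logWeight h δ B) volume 0 δ := hlog.congr_ae a1
  have i2 : IntervalIntegrable (logWeight h δ B) volume δ (1 / 2) :=
    hi.neg.congr (c2.mono Set.uIoc_subset_uIcc)
  have i3 := i1.trans i2
  have i4 : IntervalIntegrable (logWeight h δ B) volume (-1 / 2) 0 := by
    have := i3.comp_mul_left (c := -1)
    simp only [neg_mul, one_mul, logWeight_neg] at this
    norm_num at this ⊢
    exact this.symm
  have i5 := i4.trans i3
  refine ⟨i5, ?_⟩
  rw [neg_div] at i5 ⊢
  rw [integral_symm_eq (by norm_num) i5]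
  simp only [logWeight_neg, ← two_mul]
  rw [intervalIntegral.integral_const_mul, ← intervalIntegral.integral_add_adjacent_intervals i1 i2,
    ← intervalIntegral.integral_congr c2, intervalIntegral.integral_neg,
    ← intervalIntegral.integral_congr_ae_restrict a1,
    intervalIntegral.integral_sub intervalIntegral.intervalIntegrable_log' (by simp), integral_log,
    intervalIntegral.integral_const]
  simp
  ring

lemma exp_logWeight_of_lt (h : ℝ → ℝ) {δ θ : ℝ} (B : ℝ) (h0 : 0 < θ) (h1 : θ < δ) :
    Real.exp (logWeight h δ B θ) = θ * Real.exp (-B) := by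
  rw [logWeight, abs_of_pos h0, if_pos h1, sub_eq_add_neg, Real.exp_add, Real.exp_log h0]

lemma exp_logWeight_of_le (h : ℝ → ℝ) {δ θ : ℝ} (B : ℝ) (h0 : 0 < θ) (h1 : δ ≤ θ) :
    Real.exp (logWeight h δ B θ) = Real.exp (-h θ) := by
  rw [logWeight, abs_of_pos h0, if_neg (not_lt.2 h1)]

lemma energy_eq_symmSq {h : ℝ → ℝ} (hh : IsDeepProfile h) (P : ℂ[X]) :
    IntervalIntegrable (fun θ => symmSq P θ * Real.exp (-h θ)) volume 0 (1 / 2) ∧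
    energy h P = ∫ θ in (0 : ℝ)..(1 / 2), symmSq P θ * Real.exp (-h θ) := by
  have h1 := hh.energy_integrable P
  constructor
  · have := hh.intervalIntegrable_weight (continuous_symmSq P)
    have h2 := this.mono_set (c := 0) (d := 1 / 2) (Set.uIcc_subset_uIcc
      (by rw [Set.uIcc_of_le (by norm_num)]; norm_num) Set.right_mem_uIcc)
    refine h2.congr fun θ hθ => ?_
    rw [Set.uIoc_of_le (by norm_num)] at hθ
    simp only [abs_of_pos hθ.1]
  · unfold energy
    rw [neg_div] at h1 ⊢
    rw [integral_symm_eq (by norm_num) h1]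
    refine intervalIntegral.integral_congr fun θ hθ => ?_
    rw [Set.uIcc_of_le (by norm_num)] at hθ
    simp only [abs_neg, abs_of_nonneg hθ.1, symmSq]
    ring

lemma intervalIntegrable_mul_exp_logWeight {h : ℝ → ℝ} (hh : IsDeepProfile h) {δ : ℝ} (B : ℝ)
    (hδ : 0 < δ) (hδ' : δ ≤ 1 / 4) {g : ℝ → ℝ} (hg : Continuous g) :
    IntervalIntegrable (fun θ => g θ * Real.exp (logWeight h δ B θ)) volume 0 δ ∧
    IntervalIntegrable (fun θ => g θ * Real.exp (logWeight h δ B θ)) volume δ (1 / 2) := by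
  constructor
  · have : IntervalIntegrable (fun θ => g θ * (θ * Real.exp (-B)))
      volume 0 δ := Continuous.intervalIntegrable (by fun_prop) _ _
    refine this.congr_ae ?_
    rw [Set.uIoc_of_le hδ.le, ← restrict_Ioo_eq_restrict_Ioc]
    refine (ae_restrict_iff' measurableSet_Ioo).2 (ae_of_all _ fun θ hθ => ?_)
    simp only
    rw [exp_logWeight_of_lt h B hθ.1 hθ.2]
  · have h2 := (hh.intervalIntegrable_weight hg).mono_set (c := δ) (d := 1 / 2)
      (Set.uIcc_subset_uIcc (by rw [Set.uIcc_of_le (by norm_num)]; constructor <;> linarith)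
        Set.right_mem_uIcc)
    refine h2.congr fun θ hθ => ?_
    rw [Set.uIoc_of_le (by linarith)] at hθ
    rw [exp_logWeight_of_le h B (hδ.trans hθ.1) hθ.1.le, abs_of_pos (hδ.trans hθ.1)]

lemma integral_mul_exp_logWeight {h : ℝ → ℝ} {δ : ℝ} (B : ℝ)
    (hδ : 0 < δ) (hδ' : δ ≤ 1 / 4) (g : ℝ → ℝ) :
    ∫ θ in (0 : ℝ)..δ, g θ * Real.exp (logWeight h δ B θ) =
      Real.exp (-B) * ∫ θ in (0 : ℝ)..δ, g θ * θ ∧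
    ∫ θ in δ..(1 / 2), g θ * Real.exp (logWeight h δ B θ) =
      ∫ θ in δ..(1 / 2), g θ * Real.exp (-h θ) := by
  constructor
  · rw [← intervalIntegral.integral_const_mul]
    refine intervalIntegral.integral_congr_ae_restrict ?_
    rw [Set.uIoc_of_le hδ.le, ← restrict_Ioo_eq_restrict_Ioc]
    refine (ae_restrict_iff' measurableSet_Ioo).2 (ae_of_all _ fun θ hθ => ?_)
    simp only
    rw [exp_logWeight_of_lt h B hθ.1 hθ.2]
    ring
  · refine intervalIntegral.integral_congr fun θ hθ => ?_
    rw [Set.uIcc_of_le (by linarith)] at hθ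
    rw [exp_logWeight_of_le h B (hδ.trans_le hθ.1) hθ.1]

/-- The Szegő type lower bound for the energy of monic polynomials. -/
lemma le_energy_of_monic {h : ℝ → ℝ} (hh : IsDeepProfile h) {P : ℂ[X]} (hP : P.Monic) {δ : ℝ}
    (hδ : 0 < δ) (hδ' : δ ≤ 1 / 4) :
    Real.exp (2 * (δ * Real.log δ - δ - δ * (h δ + (P.natDegree + 1) * (9 * δ)) -
      ∫ θ in δ..(1 / 2), h θ)) ≤ 2 * energy h P := by
  -- This `B` cancels the Remez factor and leaves `e^{-h(δ)}`. As `h ≤ h(δ)` on `[δ, 1/2]`, the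
  -- modified mass near 1 is then at most the true energy, whence the factor 2 in the conclusion.
  set B := h δ + (P.natDegree + 1) * (9 * δ) with hB
  obtain ⟨hu, hint⟩ := logWeight_integrable_integral (B := B) hh hδ hδ'
  obtain ⟨hE, hE'⟩ := energy_eq_symmSq hh P
  set f : ℝ → ℝ := fun θ => ‖P.eval (circlePoint θ)‖ ^ 2 * Real.exp (logWeight h δ B θ) with hf
  have hsum : ∀ θ, f θ + f (-θ) = symmSq P θ * Real.exp (logWeight h δ B θ) := fun θ => by
    simp only [hf, logWeight_neg, symmSq]; ring
  have i3 : IntervalIntegrable f volume 0 (1 / 2) := by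
    obtain ⟨i1, i2⟩ := intervalIntegrable_mul_exp_logWeight hh B hδ hδ'
      (g := fun θ => ‖P.eval (circlePoint θ)‖ ^ 2) (by fun_prop)
    exact i1.trans i2
  have i1' : IntervalIntegrable (fun θ => f (-θ)) volume 0 (1 / 2) := by
    obtain ⟨i1, i2⟩ := intervalIntegrable_mul_exp_logWeight hh B hδ hδ'
      (g := fun θ => ‖P.eval (circlePoint (-θ))‖ ^ 2) (by fun_prop)
    simp only [hf, logWeight_neg]
    exact i1.trans i2
  have i4 : IntervalIntegrable f volume (-(1 / 2)) (1 / 2) := by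
    have := i1'.comp_mul_left (c := -1)
    simp only [neg_mul, one_mul, neg_neg, div_neg, div_one, neg_zero] at this
    exact this.symm.trans i3
  have key := exp_integral_le_of_monic hP hu (by rw [neg_div]; exact i4)
  rw [hint, neg_div, integral_symm_eq (by norm_num) i4] at key
  refine key.trans ?_
  simp only [hsum]
  obtain ⟨j1, j2⟩ := intervalIntegrable_mul_exp_logWeight hh B hδ hδ' (continuous_symmSq P)
  obtain ⟨e1, e2⟩ := integral_mul_exp_logWeight (h := h) B hδ hδ' (symmSq P)
  have sub1 : Set.uIcc δ (1 / 2) ⊆ Set.uIcc 0 (1 / 2) := Set.uIcc_subset_uIcc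
    (by rw [Set.uIcc_of_le (by norm_num)]; exact ⟨hδ.le, by linarith⟩) Set.right_mem_uIcc
  have sub2 : Set.uIcc 0 δ ⊆ Set.uIcc 0 (1 / 2) := Set.uIcc_subset_uIcc Set.left_mem_uIcc
    (by rw [Set.uIcc_of_le (by norm_num)]; exact ⟨hδ.le, by linarith⟩)
  rw [← intervalIntegral.integral_add_adjacent_intervals j1 j2, e1, e2]
  have b1 : ∫ θ in δ..(1 / 2), symmSq P θ * Real.exp (-h θ) ≤ energy h P := by
    rw [hE', ← intervalIntegral.integral_add_adjacent_intervals (hE.mono_set sub2)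
      (hE.mono_set sub1)]
    have : 0 ≤ ∫ θ in (0 : ℝ)..δ, symmSq P θ * Real.exp (-h θ) :=
      intervalIntegral.integral_nonneg hδ.le fun θ _ =>
        mul_nonneg (symmSq_nonneg _ _) (Real.exp_pos _).le
    linarith
  have b2 : Real.exp (-h δ) * ∫ θ in δ..(1 / 2), symmSq P θ ≤
      ∫ θ in δ..(1 / 2), symmSq P θ * Real.exp (-h θ) := by
    rw [← intervalIntegral.integral_const_mul]
    refine intervalIntegral.integral_mono_on (by linarith)
      (Continuous.intervalIntegrable (by fun_prop) _ _) (hE.mono_set sub1) fun θ hθ => ?_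
    rw [mul_comm]
    refine mul_le_mul_of_nonneg_left (Real.exp_le_exp.2 (neg_le_neg ?_)) (symmSq_nonneg _ _)
    exact hh.anti ⟨hδ, by linarith⟩ ⟨hδ.trans_le hθ.1, hθ.2⟩ hθ.1
  have b3 := mul_le_mul_of_nonneg_left (remez_arc P hδ hδ') (Real.exp_pos (-B)).le
  rw [← mul_assoc, ← Real.exp_add, show -B + (P.natDegree + 1) * (9 * δ) = -h δ by
    rw [hB]; ring] at b3
  linarith

/-- The constant 3 absorbs `δ log δ ≥ -1`, the term `δ`, the factor 2 in front of the energy, and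
the `9 δ²` that comes from `n + 1` in place of `n`. -/
lemma szegoError_pos_and_neg_log_le {h : ℝ → ℝ} (hh : IsDeepProfile h) (n : ℕ) {δ : ℝ}
    (hδ : 0 < δ) (hδ' : δ ≤ 1 / 4) :
    0 < szegoError (deepZeroMeasure h) n ∧
    -Real.log (szegoError (deepZeroMeasure h) n) ≤
      3 + δ * h δ + 9 * (n * δ ^ 2) + ∫ θ in δ..(1 / 2), h θ := by
  set V := 3 + δ * h δ + 9 * (n * δ ^ 2) + ∫ θ in δ..(1 / 2), h θ with hV
  have key : Real.exp (-V) ≤ szegoError (deepZeroMeasure h) n := by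
    refine hh.le_szegoError fun P hP hn => Real.le_sqrt_of_sq_le ?_
    have h1 := le_energy_of_monic hh hP hδ hδ'
    rw [hn] at h1
    have h2 : 2 * Real.exp (-V) ^ 2 ≤ Real.exp (1 + 2 * -V) := by
      rw [Real.exp_add, two_mul (-V), Real.exp_add, ← sq]
      have := Real.add_one_le_exp 1
      exact mul_le_mul_of_nonneg_right (by linarith) (by positivity)
    have h3 : -1 ≤ δ * Real.log δ := by
      have := Real.one_sub_inv_le_log_of_pos hδ
      have := mul_le_mul_of_nonneg_left this hδ.le
      rw [mul_sub, mul_inv_cancel₀ hδ.ne'] at this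
      linarith
    have h4 : Real.exp (1 + 2 * -V) ≤ Real.exp (2 * (δ * Real.log δ - δ -
        δ * (h δ + (n + 1) * (9 * δ)) - ∫ θ in δ..(1 / 2), h θ)) := by
      refine Real.exp_le_exp.2 ?_
      rw [hV]
      nlinarith
    linarith
  have hpos := (Real.exp_pos _).trans_le key
  refine ⟨hpos, ?_⟩
  rw [neg_le]
  exact (Real.le_log_iff_exp_le hpos).2 key

/-! ### Lower bound for `|log e_n|` from Chebyshev polynomials of an arc. -/

lemma IsDeepProfile.energy_le {h : ℝ → ℝ} (hh : IsDeepProfile h) {P : ℂ[X]} {M : ℝ}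
    (H : ∀ θ : ℝ, |θ| ∈ Set.Ioc (0 : ℝ) (1 / 2) →
      ‖P.eval (circlePoint θ)‖ ^ 2 * Real.exp (-h |θ|) ≤ M) : energy h P ≤ M := by
  have h1 : energy h P ≤ ∫ _ in (-1 / 2 : ℝ)..(1 / 2), M := by
    refine intervalIntegral.integral_mono_ae_restrict (by norm_num) (hh.energy_integrable P)
      (by simp) ?_
    have h0 : ∀ᵐ θ : ℝ ∂(volume.restrict (Set.Icc (-1 / 2) (1 / 2))), θ ≠ 0 :=
      Measure.ae_ne _ 0
    filter_upwards [h0, ae_restrict_mem measurableSet_Icc] with θ hθ hm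
    exact H θ ⟨abs_pos.2 hθ, abs_le.2 ⟨by linarith [hm.1], hm.2⟩⟩
  rw [intervalIntegral.integral_const] at h1
  norm_num at h1
  exact h1

lemma IsDeepProfile.le_neg_log_szegoError {h : ℝ → ℝ} (hh : IsDeepProfile h) {P : ℂ[X]}
    (hP : P.Monic) {n : ℕ} (hn : P.natDegree ≤ n) {x : ℝ}
    (H : ∀ θ : ℝ, |θ| ∈ Set.Ioc (0 : ℝ) (1 / 2) →
      ‖P.eval (circlePoint θ)‖ ^ 2 * Real.exp (-h |θ|) ≤ Real.exp (-(2 * x))) :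
    x ≤ -Real.log (szegoError (deepZeroMeasure h) n) := by
  have h0 := (szegoError_pos_and_neg_log_le hh n (δ := 1 / 4) (by norm_num) le_rfl).1
  have h1 : szegoError (deepZeroMeasure h) n ≤ Real.exp (-x) := by
    refine (hh.szegoError_le_of_natDegree_le hP hn).trans
      ((Real.sqrt_le_sqrt (hh.energy_le H)).trans (le_of_eq ?_))
    rw [show -(2 * x) = -x + -x by ring, Real.exp_add, Real.sqrt_mul_self (Real.exp_pos _).le]
  rw [le_neg]
  exact (Real.log_le_iff_le_exp h0).2 h1

/-- A real polynomial of degree `m` in `cos 2πθ` lifts to a polynomial of degree `2 m` in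
`e^{2πiθ}` of the same modulus. -/
lemma exists_monic_norm_eq_eval_cos {A : ℝ[X]} {m : ℕ} (hd : A.natDegree ≤ m)
    (hA : A.coeff m = 2 ^ m) : ∃ Q : ℂ[X], Q.Monic ∧ Q.natDegree = 2 * m ∧
      ∀ θ, ‖Q.eval (circlePoint θ)‖ = |A.eval (Real.cos (2 * Real.pi * θ))| := by
  -- On the circle `z² + 1 = 2 z cos 2πθ`, so `t j` equals `z^m (2 cos 2πθ)^j`; the leading
  -- coefficient `2 ^ m` of `A` is what makes the lift monic.
  set t : ℕ → ℂ[X] := fun j => X ^ (m - j) * (X ^ 2 + 1) ^ j with ht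
  have hq : (X ^ 2 + 1 : ℂ[X]).Monic := by monicity!
  have hq2 : (X ^ 2 + 1 : ℂ[X]).natDegree = 2 := by compute_degree!
  have htm : ∀ j, (t j).Monic := fun j => (monic_X_pow _).mul (hq.pow j)
  have htd : ∀ j, j ≤ m → (t j).natDegree = m + j := fun j hj => by
    rw [ht, (monic_X_pow _).natDegree_mul (hq.pow j), hq.natDegree_pow, natDegree_X_pow, hq2]
    omega
  set Q : ℂ[X] := ∑ j ∈ Finset.range (m + 1), C ((A.coeff j / 2 ^ j : ℝ) : ℂ) * t j with hQ
  have hsplit : Q = (∑ j ∈ Finset.range m, C ((A.coeff j / 2 ^ j : ℝ) : ℂ) * t j) + t m := by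
    rw [hQ, Finset.sum_range_succ, hA, div_self (by positivity)]
    simp
  have hlow : (∑ j ∈ Finset.range m, C ((A.coeff j / 2 ^ j : ℝ) : ℂ) * t j).degree <
      (t m).degree := by
    rw [degree_eq_natDegree (htm m).ne_zero, htd m le_rfl]
    refine (degree_sum_le _ _).trans_lt ((Finset.sup_lt_iff (WithBot.bot_lt_coe _)).2 fun j hj => ?_)
    have hj' := Finset.mem_range.1 hj
    refine (degree_le_of_natDegree_le ((natDegree_C_mul_le _ _).trans
      (htd j hj'.le).le)).trans_lt ?_
    exact_mod_cast Nat.add_lt_add_left hj' m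
  refine ⟨Q, ?_, ?_, fun θ => ?_⟩
  · rw [hsplit]
    exact (htm m).add_of_right hlow
  · rw [hsplit, natDegree_add_eq_right_of_degree_lt hlow, htd m le_rfl]
    omega
  · have hz : circlePoint θ ≠ 0 := by
      rw [← norm_pos_iff]; simp
    have hcos : circlePoint θ ^ 2 + 1 =
        circlePoint θ * (2 * (Real.cos (2 * Real.pi * θ) : ℝ) : ℂ) := by
      rw [← circlePoint_re]
      have h1 : (2 * ((circlePoint θ).re : ℝ) : ℂ) =
          circlePoint θ + (starRingEnd ℂ) (circlePoint θ) := by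
        rw [Complex.add_conj]; push_cast; ring
      rw [h1, mul_add, Complex.mul_conj, Complex.normSq_eq_norm_sq, norm_circlePoint]
      simp [sq]
    have hev : Q.eval (circlePoint θ) =
        circlePoint θ ^ m * ((A.eval (Real.cos (2 * Real.pi * θ)) : ℝ) : ℂ) := by
      rw [hQ, eval_finsetSum, A.eval_eq_sum_range' (Nat.lt_succ_of_le hd)]
      rw [Complex.ofReal_sum, Finset.mul_sum]
      refine Finset.sum_congr rfl fun j hj => ?_
      have hj' : j ≤ m := Nat.lt_succ_iff.1 (Finset.mem_range.1 hj)
      simp only [ht, eval_mul, eval_C, eval_pow, eval_add, eval_X, eval_one]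
      rw [hcos, mul_pow, mul_pow]
      have : circlePoint θ ^ m = circlePoint θ ^ (m - j) * circlePoint θ ^ j := by
        rw [← pow_add, Nat.sub_add_cancel hj']
      rw [this]
      push_cast
      field_simp
    rw [hev, norm_mul, norm_pow, norm_circlePoint, one_pow, one_mul, Complex.norm_real,
      Real.norm_eq_abs]

/-- The Chebyshev polynomial is pulled back by the affine map that straightens the arc. Making the
lift monic multiplies it by at most `2 c^m`, and `c ≤ 1 - 4δ²` gives the decay; on the short arc
only the growth bound `e^{9mδ}` remains. -/
lemma exists_chebyshev_on_arc (m : ℕ) {δ : ℝ} (hδ : 0 < δ) (hδ' : δ ≤ 1 / 4) :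
    ∃ Q : ℂ[X], Q.Monic ∧ Q.natDegree = 2 * m ∧
      (∀ θ, δ ≤ |θ| → |θ| ≤ 1 / 2 →
        ‖Q.eval (circlePoint θ)‖ ≤ 2 * Real.exp (-(4 * (m * δ ^ 2)))) ∧
      (∀ θ, |θ| ≤ δ → ‖Q.eval (circlePoint θ)‖ ≤ 2 * Real.exp (m * (9 * δ))) := by
  obtain ⟨hcos2, hc2, hc1, hgr⟩ := cos_sq_arc hδ hδ'
  set c := Real.cos (Real.pi * δ) ^ 2
  have hc0 : 0 < c := by linarith
  set L : ℝ[X] := C c⁻¹ * X + C (c⁻¹ - 1) with hL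
  have hLd : L.natDegree = 1 := natDegree_linear (inv_ne_zero hc0.ne')
  have hLl : L.leadingCoeff = c⁻¹ := leadingCoeff_linear (inv_ne_zero hc0.ne')
  have hTd : (Chebyshev.T ℝ m).natDegree = m := by rw [Chebyshev.natDegree_T]; simp
  have hcompd : ((Chebyshev.T ℝ m).comp L).natDegree = m := by
    rw [natDegree_comp, hTd, hLd, mul_one]
  have hcompl : ((Chebyshev.T ℝ m).comp L).coeff m = 2 ^ (m - 1) * c⁻¹ ^ m := by
    have h1 : ((Chebyshev.T ℝ m).comp L).coeff m = ((Chebyshev.T ℝ m).comp L).leadingCoeff := by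
      rw [leadingCoeff, hcompd]
    rw [h1, leadingCoeff_comp (by simp [hLd]), Chebyshev.leadingCoeff_T, hLl, hTd]
    simp
  set a : ℝ := 2 ^ m / (2 ^ (m - 1) * c⁻¹ ^ m) with ha
  obtain ⟨Q, hQ, hQd, hQn⟩ := exists_monic_norm_eq_eval_cos
    (A := C a * (Chebyshev.T ℝ m).comp L) (m := m) ((natDegree_C_mul_le _ _).trans hcompd.le)
    (by rw [coeff_C_mul, hcompl, ha]; field_simp)
  have ha0 : 0 < a := by positivity
  have ha1 : a ≤ 2 * c ^ m := by
    rw [ha, inv_pow, ← div_eq_mul_inv, div_div_eq_mul_div, div_le_iff₀ (by positivity)]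
    -- Only an inequality, because `m - 1` is truncated when `m = 0`.
    have : (2 : ℝ) ^ m ≤ 2 * 2 ^ (m - 1) := by
      rw [← pow_succ']
      exact pow_le_pow_right₀ (by norm_num) (by omega)
    nlinarith [pow_pos hc0 m]
  have hcm : c ^ m ≤ Real.exp (-(4 * (m * δ ^ 2))) := by
    have : c ≤ Real.exp (-(4 * δ ^ 2)) := by
      linarith [Real.add_one_le_exp (-(4 * δ ^ 2))]
    refine (pow_le_pow_left₀ hc0.le this m).trans (le_of_eq ?_)
    rw [← Real.exp_nat_mul]
    congr 1
    ring
  have hev : ∀ θ, ‖Q.eval (circlePoint θ)‖ = a *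
      |(Chebyshev.T ℝ m).eval ((Real.cos (2 * Real.pi * θ) + 1) / c - 1)| := fun θ => by
    rw [hQn, eval_mul, eval_C, abs_mul, abs_of_pos ha0, eval_comp, hL]
    simp only [eval_add, eval_mul, eval_C, eval_X]
    congr 3
    field_simp
    ring
  have hcosabs : ∀ θ : ℝ, Real.cos (2 * Real.pi * θ) = Real.cos (2 * Real.pi * |θ|) := fun θ => by
    rw [← Real.cos_abs, abs_mul, abs_of_pos Real.two_pi_pos]
  have hout : ∀ θ : ℝ, Real.cos (2 * Real.pi * θ) ≤ 2 * c - 1 →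
      |(Chebyshev.T ℝ m).eval ((Real.cos (2 * Real.pi * θ) + 1) / c - 1)| ≤ 1 := fun θ hθ => by
    have h0 := Real.neg_one_le_cos (2 * Real.pi * θ)
    refine abs_eval_chebyshev_T_le_one ?_ ?_ m
    · have : 0 ≤ (Real.cos (2 * Real.pi * θ) + 1) / c := div_nonneg (by linarith) hc0.le
      linarith
    · rw [sub_le_iff_le_add, div_le_iff₀ hc0]
      linarith
  refine ⟨Q, hQ, hQd, fun θ h1 h2 => ?_, fun θ h1 => ?_⟩
  · rw [hev]
    refine (mul_le_mul ha1 (hout θ ?_) (abs_nonneg _) (by positivity)).trans (by linarith)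
    rw [← hcos2, hcosabs]
    exact Real.cos_le_cos_of_nonneg_of_le_pi (by positivity) (by nlinarith [Real.pi_pos])
      (by nlinarith [Real.pi_pos])
  · rw [hev]
    have ha2 : a ≤ 2 := ha1.trans (by
      have := pow_le_one₀ hc0.le (by nlinarith [sq_nonneg δ] : c ≤ 1) (n := m)
      linarith)
    refine mul_le_mul ha2 ?_ (abs_nonneg _) (by norm_num)
    rcases le_total (Real.cos (2 * Real.pi * θ)) (2 * c - 1) with h | h
    · exact (hout θ h).trans (Real.one_le_exp (by positivity))
    · refine chebyshev_T_le_exp (by positivity) ?_ (le_trans ?_ hgr) m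
      · rw [le_sub_iff_add_le, le_div_iff₀ hc0]
        linarith
      · rw [sub_le_sub_iff_right]
        refine div_le_div_of_nonneg_right ?_ hc0.le
        linarith [Real.cos_le_one (2 * Real.pi * θ)]

/-- If `h(δ)` is large compared to `n δ`, polynomials that are small off the arc `|θ| < δ`
show that `|log e_n|` is at least of order `n δ²`. -/
lemma le_neg_log_szegoError_of_gap {h : ℝ → ℝ} (hh : IsDeepProfile h) {n : ℕ} {δ : ℝ}
    (hδ : 0 < δ) (hδ' : δ ≤ 1 / 4) (hn : 10 * (n * δ) ≤ h δ) :
    2 * (n * δ ^ 2) - 3 ≤ -Real.log (szegoError (deepZeroMeasure h) n) := by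
  obtain ⟨Q, hQ, hQd, hQ1, hQ2⟩ := exists_chebyshev_on_arc (n / 2) hδ hδ'
  have hm1 : ((n / 2 : ℕ) : ℝ) ≤ n / 2 := Nat.cast_div_le
  have hm2 : (n : ℝ) / 2 - 1 / 2 ≤ ((n / 2 : ℕ) : ℝ) := by
    have : n ≤ 2 * (n / 2) + 1 := by omega
    have : (n : ℝ) ≤ 2 * ((n / 2 : ℕ) : ℝ) + 1 := by exact_mod_cast this
    linarith
  set m := n / 2
  have hδ2 : δ ^ 2 ≤ 1 / 16 := by nlinarith
  have hexp : 4 * Real.exp (-(8 * (m * δ ^ 2))) ≤ Real.exp (-(2 * (2 * (n * δ ^ 2) - 3))) := by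
    have h4 : (4 : ℝ) ≤ Real.exp 3 := by linarith [Real.add_one_le_exp 3]
    calc _ ≤ Real.exp 3 * Real.exp (-(8 * (m * δ ^ 2))) :=
          mul_le_mul_of_nonneg_right h4 (Real.exp_pos _).le
      _ = Real.exp (3 + -(8 * (m * δ ^ 2))) := (Real.exp_add _ _).symm
      _ ≤ _ := Real.exp_le_exp.2 (by nlinarith [mul_le_mul_of_nonneg_right hm2 (sq_nonneg δ)])
  have hsq : ∀ x, (2 * Real.exp x) ^ 2 = 4 * Real.exp (2 * x) := fun x => by
    rw [mul_pow, ← Real.exp_nat_mul]; norm_num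
  refine hh.le_neg_log_szegoError hQ (by omega) fun θ hθ => le_trans ?_ hexp
  rcases le_total δ |θ| with h1 | h1
  · have h2 := pow_le_pow_left₀ (norm_nonneg _) (hQ1 θ h1 hθ.2) 2
    rw [hsq, show 2 * -(4 * (m * δ ^ 2)) = -(8 * (m * δ ^ 2)) by ring] at h2
    refine (mul_le_of_le_one_right (by positivity) ?_).trans h2
    exact Real.exp_le_one_iff.2 (neg_nonpos.2 (hh.nonneg _ hθ))
  -- On the short arc `|Q|²` has exponent `18 m δ ≤ 9 n δ`. The hypothesis `h(δ) ≥ 10 n δ` leaves a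
  -- surplus `n δ ≥ 2 m δ ≥ 8 m δ²`, the decay obtained on the long arc.
  · have h2 := pow_le_pow_left₀ (norm_nonneg _) (hQ2 θ h1) 2
    rw [hsq] at h2
    have h3 : h δ ≤ h |θ| := hh.anti hθ ⟨hδ, by linarith⟩ h1
    calc _ ≤ 4 * Real.exp (2 * (m * (9 * δ))) * Real.exp (-h δ) :=
          mul_le_mul h2 (Real.exp_le_exp.2 (neg_le_neg h3)) (Real.exp_pos _).le (by positivity)
      _ = 4 * Real.exp (2 * (m * (9 * δ)) + -h δ) := by rw [mul_assoc, ← Real.exp_add]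
      _ ≤ _ := by
        refine mul_le_mul_of_nonneg_left (Real.exp_le_exp.2 ?_) (by norm_num)
        have h5 : (m : ℝ) * δ ≤ n / 2 * δ := mul_le_mul_of_nonneg_right hm1 hδ.le
        have h6 : (m : ℝ) * δ ^ 2 ≤ m * δ * (1 / 4) := by
          rw [sq, ← mul_assoc]
          exact mul_le_mul_of_nonneg_left hδ' (by positivity)
        nlinarith

/-! ### Lower bound for `|log e_n|` from sums of Fejér kernels. -/

/-- Reflecting a polynomial `f` with `f(0) ≠ 0` yields test polynomials for `e_n`. -/
lemma IsDeepProfile.le_neg_log_szegoError_of_coeff_zero {h : ℝ → ℝ} (hh : IsDeepProfile h)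
    {f : ℂ[X]} {n : ℕ} (hd : f.natDegree ≤ n) (h0 : f.coeff 0 ≠ 0) {x : ℝ}
    (H : ∀ θ : ℝ, |θ| ∈ Set.Ioc (0 : ℝ) (1 / 2) →
      ‖f.eval (circlePoint θ)‖ ^ 2 * Real.exp (-h |θ|) ≤
        ‖f.coeff 0‖ ^ 2 * Real.exp (-(2 * x))) :
    x ≤ -Real.log (szegoError (deepZeroMeasure h) n) := by
  have hrc : (f.reflect n).coeff n = f.coeff 0 := by
    rw [coeff_reflect, revAt_le le_rfl, Nat.sub_self]
  have hrd : (f.reflect n).natDegree = n :=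
    le_antisymm ((natDegree_reflect_le).trans (by simp [hd]))
      (le_natDegree_of_ne_zero (by rwa [hrc]))
  have hrl : (f.reflect n).leadingCoeff = f.coeff 0 := by rw [leadingCoeff, hrd, hrc]
  have hmonic : (C (f.coeff 0)⁻¹ * f.reflect n).Monic := by
    rw [Monic, leadingCoeff_mul, leadingCoeff_C, hrl, inv_mul_cancel₀ h0]
  refine hh.le_neg_log_szegoError hmonic ((natDegree_C_mul_le _ _).trans hrd.le) fun θ hθ => ?_
  have hz : (circlePoint (-θ))⁻¹ = circlePoint θ := by
    rw [inv_eq_iff_eq_inv, eq_comm, inv_eq_of_mul_eq_one_right]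
    rw [← circlePoint_add]
    simp [circlePoint]
  -- The reflected polynomial is `z^n f(1/z)`, and the weight is even in `θ`.
  have hev : ‖(f.reflect n).eval (circlePoint θ)‖ = ‖f.eval (circlePoint (-θ))‖ := by
    let _ : Invertible (circlePoint (-θ)) := invertibleOfNonzero (by
      rw [← norm_pos_iff]; simp)
    have h1 := eval₂_reflect_mul_pow (RingHom.id ℂ) (circlePoint (-θ)) n f hd
    rw [invOf_eq_inv, hz] at h1
    have h2 := congrArg norm h1
    rw [norm_mul, norm_pow, norm_circlePoint, one_pow, mul_one] at h2
    exact h2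
  have h3 := H (-θ) (by rwa [abs_neg])
  rw [abs_neg] at h3
  rw [eval_mul, eval_C, norm_mul, mul_pow, hev, norm_inv, inv_pow, mul_assoc,
    inv_mul_le_iff₀ (by positivity)]
  exact h3

/-- The analytic Dirichlet sums `1 + 2 ∑_{1 ≤ j ≤ e} z^j`. -/
noncomputable def dirichletPoly (e : ℕ) : ℂ[X] := 1 + ∑ j ∈ Finset.range e, C 2 * X ^ (j + 1)

/-- `d` times the analytic polynomial of degree less than `d` whose real part is the `d`-th
Fejér kernel. -/
noncomputable def fejerPoly (d : ℕ) : ℂ[X] := ∑ e ∈ Finset.range d, dirichletPoly e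

lemma natDegree_fejerPoly_le (d : ℕ) : (fejerPoly d).natDegree ≤ d := by
  refine natDegree_sum_le_of_forall_le _ _ fun e he => (natDegree_add_le _ _).trans ?_
  rw [natDegree_one, max_eq_right (Nat.zero_le _)]
  refine natDegree_sum_le_of_forall_le _ _ fun j hj => (natDegree_C_mul_X_pow_le _ _).trans ?_
  simp only [Finset.mem_range] at he hj
  omega

lemma coeff_zero_fejerPoly (d : ℕ) : (fejerPoly d).coeff 0 = d := by
  simp [fejerPoly, dirichletPoly]

lemma norm_eval_fejerPoly_le (d : ℕ) {z : ℂ} (hz : ‖z‖ = 1) :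
    ‖(fejerPoly d).eval z‖ ≤ (d : ℝ) ^ 2 := by
  have h1 : ∀ e, ‖(dirichletPoly e).eval z‖ ≤ 1 + 2 * e := fun e => by
    rw [dirichletPoly, eval_add, eval_one, eval_finsetSum]
    refine (norm_add_le _ _).trans (add_le_add (by simp) ((norm_sum_le _ _).trans (le_of_eq ?_)))
    simp only [eval_mul, eval_C, eval_pow, eval_X, norm_mul, norm_pow, hz, one_pow, mul_one,
      Finset.sum_const, Finset.card_range, nsmul_eq_mul, Complex.norm_ofNat]
    ring
  rw [fejerPoly, eval_finsetSum]
  refine (norm_sum_le _ _).trans ?_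
  induction d with
  | zero => simp
  | succ d ih =>
    rw [Finset.sum_range_succ]
    push_cast
    linarith [h1 d]

/-- With `G` the geometric sum, the next one is `1 + z G`; as `|z G| = |G|`, its squared modulus
grows by `1 + 2 Re (z G)`, the real part of the next Dirichlet sum. -/
lemma re_eval_fejerPoly (d : ℕ) {z : ℂ} (hz : ‖z‖ = 1) :
    ((fejerPoly d).eval z).re = ‖∑ j ∈ Finset.range d, z ^ j‖ ^ 2 := by
  induction d with
  | zero => simp [fejerPoly]
  | succ d ih =>
    have e1 : (fejerPoly (d + 1)).eval z = (fejerPoly d).eval z + (dirichletPoly d).eval z := by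
      rw [fejerPoly, Finset.sum_range_succ, eval_add, fejerPoly]
    have e2 : (dirichletPoly d).eval z = 1 + 2 * (z * ∑ j ∈ Finset.range d, z ^ j) := by
      rw [dirichletPoly, eval_add, eval_one, eval_finsetSum, Finset.mul_sum, Finset.mul_sum]
      simp [pow_succ']
    rw [e1, Complex.add_re, ih, geom_sum_succ, e2]
    set G := ∑ j ∈ Finset.range d, z ^ j
    have e3 : ‖G‖ = ‖z * G‖ := by rw [norm_mul, hz, one_mul]
    rw [e3, Complex.sq_norm, Complex.sq_norm, Complex.normSq_apply, Complex.normSq_apply]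
    simp only [Complex.add_re, Complex.one_re, Complex.add_im, Complex.one_im, Complex.mul_re (2 : ℂ),
      Complex.re_ofNat, Complex.im_ofNat]
    ring

lemma le_norm_circlePoint_sub_one {θ : ℝ} (hθ : |θ| ≤ 1 / 2) :
    4 * |θ| ≤ ‖circlePoint θ - 1‖ := by
  have hpi := Real.pi_pos
  rw [circlePoint_eq_exp, mul_comm _ Complex.I, Complex.norm_exp_I_mul_ofReal_sub_one, norm_mul,
    Real.norm_ofNat, Real.norm_eq_abs]
  have h1 := Real.mul_abs_le_abs_sin (x := Real.pi * θ) (by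
    rw [abs_mul, abs_of_pos hpi]; nlinarith)
  rw [abs_mul, abs_of_pos hpi] at h1
  have e : 2 / Real.pi * (Real.pi * |θ|) = 2 * |θ| := by field_simp
  rw [e] at h1
  rw [show 2 * Real.pi * θ / 2 = Real.pi * θ by ring]
  linarith

lemma re_eval_fejerPoly_div_le {d : ℕ} (hd : 0 < d) {θ : ℝ}
    (hθ : |θ| ∈ Set.Ioc (0 : ℝ) (1 / 2)) :
    ((fejerPoly d).eval (circlePoint θ)).re / d ≤ min (d : ℝ) (1 / (4 * d * |θ| ^ 2)) := by
  have hd' : (0 : ℝ) < d := Nat.cast_pos.2 hd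
  have hθ0 := hθ.1
  rw [re_eval_fejerPoly d (norm_circlePoint θ)]
  refine le_min ?_ ?_
  · rw [div_le_iff₀ hd', ← sq]
    refine pow_le_pow_left₀ (norm_nonneg _) ((norm_sum_le _ _).trans (le_of_eq ?_)) 2
    simp
  · have h1 : ‖∑ j ∈ Finset.range d, circlePoint θ ^ j‖ * ‖circlePoint θ - 1‖ ≤ 2 := by
      rw [← norm_mul, geom_sum_mul]
      refine (norm_sub_le _ _).trans ?_
      simp
      norm_num
    have h2 : ‖∑ j ∈ Finset.range d, circlePoint θ ^ j‖ * (2 * |θ|) ≤ 1 := by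
      have := mul_le_mul_of_nonneg_left (le_norm_circlePoint_sub_one hθ.2)
        (norm_nonneg (∑ j ∈ Finset.range d, circlePoint θ ^ j))
      linarith
    have h3 := pow_le_pow_left₀ (by positivity) h2 2
    rw [div_le_div_iff₀ hd' (by positivity)]
    nlinarith

/-- With `exp_sub_sq_le_one_add_sq`, this compares `(1 + W/N)^N` with `e^W` at the price of `|W|²/N`
in the exponent. -/
lemma norm_one_add_sq_le (w : ℂ) : ‖1 + w‖ ^ 2 ≤ Real.exp (2 * w.re + ‖w‖ ^ 2) := by
  have : ‖1 + w‖ ^ 2 = 1 + (2 * w.re + ‖w‖ ^ 2) := by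
    rw [Complex.sq_norm, Complex.sq_norm, Complex.normSq_apply, Complex.normSq_apply]
    simp only [Complex.add_re, Complex.one_re, Complex.add_im, Complex.one_im]
    ring
  rw [this, add_comm]
  exact Real.add_one_le_exp _

lemma exp_sub_sq_le_one_add_sq {x : ℝ} (hx : 0 ≤ x) :
    Real.exp (2 * x - x ^ 2) ≤ (1 + x) ^ 2 := by
  have h1 := Real.le_log_one_add_of_nonneg hx
  have h2 : x - x ^ 2 / 2 ≤ 2 * x / (x + 2) := by
    rw [le_div_iff₀ (by linarith)]
    nlinarith [pow_nonneg hx 3]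
  have h3 : Real.exp (x - x ^ 2 / 2) ≤ 1 + x :=
    (Real.le_log_iff_exp_le (by linarith)).1 (h2.trans h1)
  have h4 := pow_le_pow_left₀ (Real.exp_pos _).le h3 2
  rw [← Real.exp_nat_mul] at h4
  refine (le_of_eq ?_).trans h4
  congr 1
  push_cast
  ring

/-- Sums of Fejér kernels minorizing `h` give lower bounds for `|log e_n|`. -/
lemma le_neg_log_szegoError_of_fejer_sum {h : ℝ → ℝ} (hh : IsDeepProfile h) {n K N : ℕ}
    (hN : 0 < N) (hn : N * 2 ^ K ≤ n) {b : ℕ → ℝ} (hb : ∀ k, 0 ≤ b k) {C₁ C₂ : ℝ}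
    (H1 : ∀ θ ∈ Set.Ioc (0 : ℝ) (1 / 2), ∑ k ∈ Finset.Icc 1 K,
      b k * min ((2 : ℝ) ^ k) (1 / (4 * 2 ^ k * θ ^ 2)) ≤ h θ / 2 + C₁)
    (H2 : (∑ k ∈ Finset.Icc 1 K, b k * 2 ^ k) ^ 2 ≤ C₂ * N) :
    ∑ k ∈ Finset.Icc 1 K, b k - C₁ - C₂ ≤ -Real.log (szegoError (deepZeroMeasure h) n) := by
  have hN' : (0 : ℝ) < N := Nat.cast_pos.2 hN
  set S := ∑ k ∈ Finset.Icc 1 K, b k with hS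
  have hS0 : 0 ≤ S := Finset.sum_nonneg fun k _ => hb k
  -- Each `fejerPoly (2 ^ k) / 2 ^ k` has value 1 at 0, real part the Fejér kernel and modulus at
  -- most `2 ^ k` on the circle. Hence `W(0) = S`, `H1` bounds `Re W`, and `H2` bounds `|W|²/N` by
  -- `C₂`.
  set W : ℂ[X] := ∑ k ∈ Finset.Icc 1 K, C ((b k / 2 ^ k : ℝ) : ℂ) * fejerPoly (2 ^ k) with hW
  set f : ℂ[X] := (1 + C ((N : ℂ)⁻¹) * W) ^ N with hf
  have hWd : W.natDegree ≤ 2 ^ K := natDegree_sum_le_of_forall_le _ _ fun k hk =>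
    (natDegree_C_mul_le _ _).trans ((natDegree_fejerPoly_le _).trans
      (Nat.pow_le_pow_right (by norm_num) (Finset.mem_Icc.1 hk).2))
  have hfd : f.natDegree ≤ n := by
    refine (natDegree_pow_le).trans ((Nat.mul_le_mul_left N ?_).trans hn)
    refine (natDegree_add_le _ _).trans ?_
    rw [natDegree_one, max_eq_right (Nat.zero_le _)]
    exact (natDegree_C_mul_le _ _).trans hWd
  have hW0 : W.coeff 0 = (S : ℂ) := by
    rw [hW, finsetSum_coeff, hS, Complex.ofReal_sum]
    refine Finset.sum_congr rfl fun k _ => ?_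
    rw [coeff_C_mul, coeff_zero_fejerPoly]
    push_cast
    field_simp
  have hf0 : f.coeff 0 = (((1 + S / N) ^ N : ℝ) : ℂ) := by
    rw [coeff_zero_eq_eval_zero] at hW0 ⊢
    rw [hf, eval_pow, eval_add, eval_one, eval_mul, eval_C, hW0]
    push_cast
    rw [div_eq_inv_mul]
  have hWsum : ∀ z : ℂ, W.eval z =
      ∑ k ∈ Finset.Icc 1 K, ((b k / 2 ^ k : ℝ) : ℂ) * (fejerPoly (2 ^ k)).eval z := fun z => by
    rw [hW, eval_finsetSum]
    simp
  have hWnorm : ∀ θ, ‖W.eval (circlePoint θ)‖ ≤ ∑ k ∈ Finset.Icc 1 K, b k * 2 ^ k := fun θ => by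
    rw [hWsum]
    refine (norm_sum_le _ _).trans (Finset.sum_le_sum fun k _ => ?_)
    have h1 := norm_eval_fejerPoly_le (2 ^ k) (norm_circlePoint θ)
    rw [norm_mul, Complex.norm_real, Real.norm_of_nonneg (div_nonneg (hb k) (by positivity))]
    refine (mul_le_mul_of_nonneg_left h1 (div_nonneg (hb k) (by positivity))).trans (le_of_eq ?_)
    push_cast
    field_simp
  have hWre : ∀ θ : ℝ, |θ| ∈ Set.Ioc (0 : ℝ) (1 / 2) →
      (W.eval (circlePoint θ)).re ≤ h |θ| / 2 + C₁ := fun θ hθ => by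
    refine le_trans ?_ (H1 |θ| hθ)
    rw [hWsum, Complex.re_sum]
    refine Finset.sum_le_sum fun k _ => ?_
    have h1 := re_eval_fejerPoly_div_le (d := 2 ^ k) (by positivity) hθ
    rw [Complex.re_ofReal_mul]
    push_cast at h1
    have := mul_le_mul_of_nonneg_left h1 (hb k)
    refine le_trans (le_of_eq ?_) this
    ring
  have hSle : S ≤ ∑ k ∈ Finset.Icc 1 K, b k * 2 ^ k := Finset.sum_le_sum fun k _ =>
    le_mul_of_one_le_right (hb k) (one_le_pow₀ (by norm_num))
  have hS2 : S ^ 2 ≤ C₂ * N := (pow_le_pow_left₀ hS0 hSle 2).trans H2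
  refine hh.le_neg_log_szegoError_of_coeff_zero hfd ?_ fun θ hθ => ?_
  · rw [hf0]
    exact_mod_cast (by positivity : (1 + S / N : ℝ) ^ N ≠ 0)
  · have h1 : ‖f.eval (circlePoint θ)‖ ^ 2 ≤ Real.exp (h |θ| + 2 * C₁ + C₂) := by
      rw [hf, eval_pow, norm_pow, ← pow_mul, mul_comm N 2, pow_mul]
      refine (pow_le_pow_left₀ (by positivity) ?_ N).trans
        (b := (Real.exp ((h |θ| + 2 * C₁ + C₂) / N)) ^ N) (le_of_eq ?_)
      · rw [eval_add, eval_one, eval_mul, eval_C]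
        refine (norm_one_add_sq_le _).trans (Real.exp_le_exp.2 ?_)
        have e1 : ((N : ℂ)⁻¹ * W.eval (circlePoint θ)).re =
            (W.eval (circlePoint θ)).re / N := by
          rw [show (N : ℂ)⁻¹ = (((N : ℝ)⁻¹ : ℝ) : ℂ) by push_cast; rfl, Complex.re_ofReal_mul]
          ring
        have e2 : ‖(N : ℂ)⁻¹ * W.eval (circlePoint θ)‖ = ‖W.eval (circlePoint θ)‖ / N := by
          rw [norm_mul, norm_inv, Complex.norm_natCast]
          ring
        have h3 : ‖W.eval (circlePoint θ)‖ ^ 2 ≤ C₂ * N :=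
          (pow_le_pow_left₀ (norm_nonneg _) (hWnorm θ) 2).trans H2
        rw [e1, e2, le_div_iff₀ hN', add_mul, div_pow]
        have e3 : ‖W.eval (circlePoint θ)‖ ^ 2 / (N : ℝ) ^ 2 * N =
            ‖W.eval (circlePoint θ)‖ ^ 2 / N := by field_simp
        have e4 : ‖W.eval (circlePoint θ)‖ ^ 2 / N ≤ C₂ := by rwa [div_le_iff₀ hN']
        have e5 : 2 * ((W.eval (circlePoint θ)).re / N) * N = 2 * (W.eval (circlePoint θ)).re := by
          field_simp
        rw [e3, e5]
        linarith [hWre θ hθ]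
      · rw [← Real.exp_nat_mul, mul_div_cancel₀ _ hN'.ne']
    have h2 : Real.exp (2 * S - C₂) ≤ ‖f.coeff 0‖ ^ 2 := by
      rw [hf0, Complex.norm_real, Real.norm_of_nonneg (by positivity), ← pow_mul, mul_comm N 2,
        pow_mul]
      refine le_trans ?_ (pow_le_pow_left₀ (Real.exp_pos _).le
        (exp_sub_sq_le_one_add_sq (x := S / N) (by positivity)) N)
      rw [← Real.exp_nat_mul]
      refine Real.exp_le_exp.2 ?_
      have e1 : (N : ℝ) * (2 * (S / N) - (S / N) ^ 2) = 2 * S - S ^ 2 / N := by field_simp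
      have e2 : S ^ 2 / N ≤ C₂ := by rwa [div_le_iff₀ hN']
      rw [e1]
      linarith
    calc _ ≤ Real.exp (h |θ| + 2 * C₁ + C₂) * Real.exp (-h |θ|) :=
          mul_le_mul_of_nonneg_right h1 (Real.exp_pos _).le
      _ = Real.exp (2 * S - C₂) * Real.exp (-(2 * (S - C₁ - C₂))) := by
          rw [← Real.exp_add, ← Real.exp_add]
          congr 1
          ring
      _ ≤ _ := mul_le_mul_of_nonneg_right h2 (Real.exp_pos _).le

/-! ### From asymptotic bounds to uniform bounds for `n ≥ 4`. -/

lemma exists_uniform_comparison {r : ℕ → ℝ} (hr : ∀ n, 4 ≤ n → 0 < r n) (ht : Tendsto r atTop atTop)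
    {l₀ k₁ K₁ B : ℝ} (hl : 0 < l₀) (hk : 0 < k₁) {N₀ : ℕ} :
    ∃ k K : ℝ, 0 < k ∧ 0 < K ∧ ∀ L : ℕ → ℝ, Monotone L → (∀ n, l₀ ≤ L n) →
      (∀ n, N₀ ≤ n → k₁ * r n - B ≤ L n ∧ L n ≤ K₁ * r n + B) →
      ∀ n, 4 ≤ n → k * r n ≤ L n ∧ L n ≤ K * r n := by
  -- Beyond `N₁` the additive error is absorbed: `B ≤ k₁ r / 2` below, `|B| ≤ |B| r` above. For the
  -- finitely many earlier `n`, `l₀` bounds `L n` from below and, by monotonicity, `L N` from above.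
  obtain ⟨N₁, hN₁⟩ := (tendsto_atTop.1 ht (max 1 (2 * B / k₁))).exists_forall_of_atTop
  set N := max 4 (max N₀ N₁) with hN
  have hne : (Finset.Icc 4 N).Nonempty := ⟨4, by simp [hN]⟩
  obtain ⟨i, hi, himin⟩ := Finset.exists_min_image _ r hne
  obtain ⟨j, hj, hjmax⟩ := Finset.exists_max_image _ r hne
  have hri := hr i (Finset.mem_Icc.1 hi).1
  have hrj := hr j (Finset.mem_Icc.1 hj).1
  have hNr : 0 < r N := hr N (le_max_left _ _)
  refine ⟨min (k₁ / 2) (l₀ / r j), |K₁| + |B| + (|K₁| * r N + |B|) / r i + 1, by positivity, by positivity, ?_⟩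
  intro L hL hL0 hLb n hn
  have hrn := hr n hn
  rcases le_total N n with h | h
  · have hN0 : N₀ ≤ n := (le_max_left _ _).trans ((le_max_right _ _).trans h)
    have hN1 : N₁ ≤ n := (le_max_right _ _).trans ((le_max_right _ _).trans h)
    obtain ⟨h1, h2⟩ := hLb n hN0
    have h3 := hN₁ n hN1
    have h4 : 1 ≤ r n := (le_max_left _ _).trans h3
    have h5 : 2 * B ≤ r n * k₁ := (div_le_iff₀ hk).1 ((le_max_right _ _).trans h3)
    constructor
    · have := mul_le_mul_of_nonneg_right (min_le_left (k₁ / 2) (l₀ / r j)) hrn.le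
      linarith
    · have h6 : K₁ * r n ≤ |K₁| * r n := mul_le_mul_of_nonneg_right (le_abs_self _) hrn.le
      have h7 : |B| ≤ |B| * r n := le_mul_of_one_le_right (abs_nonneg _) h4
      have h8 : 0 ≤ (|K₁| * r N + |B|) / r i * r n := by positivity
      have := le_abs_self B
      nlinarith
  · have hmem : n ∈ Finset.Icc 4 N := Finset.mem_Icc.2 ⟨hn, h⟩
    constructor
    · refine le_trans ?_ (hL0 n)
      refine (mul_le_mul_of_nonneg_right (min_le_right _ _) hrn.le).trans ?_
      rw [div_mul_eq_mul_div, div_le_iff₀ hrj]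
      exact mul_le_mul_of_nonneg_left (hjmax n hmem) hl.le
    · refine (hL h).trans ((hLb N ((le_max_left _ _).trans (le_max_right _ _))).2.trans ?_)
      have h6 : K₁ * r N ≤ |K₁| * r N := mul_le_mul_of_nonneg_right (le_abs_self _) hNr.le
      have h7 : |K₁| * r N + |B| ≤ (|K₁| * r N + |B|) / r i * r n := by
        rw [div_mul_eq_mul_div, le_div_iff₀ hri]
        exact mul_le_mul_of_nonneg_left (himin n hmem) (by positivity)
      have h8 : 0 ≤ (|K₁| + |B|) * r n := by positivity
      have := le_abs_self B
      nlinarith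

lemma energy_one_le {h : ℝ → ℝ} (hh : IsDeepProfile h) {δ : ℝ} (hδ : 0 < δ) (hδ' : δ ≤ 1 / 2) :
    energy h 1 ≤ 1 - 2 * δ * (1 - Real.exp (-h δ)) := by
  obtain ⟨h1, h2⟩ := energy_eq_symmSq hh 1
  have hs : ∀ θ, symmSq 1 θ = 2 := fun θ => by simp [symmSq]; norm_num
  simp only [hs] at h1 h2
  have hm : δ ∈ Set.uIcc (0 : ℝ) (1 / 2) := by
    rw [Set.uIcc_of_le (by norm_num)]; exact ⟨hδ.le, hδ'⟩
  have i1 := h1.mono_set (Set.uIcc_subset_uIcc Set.left_mem_uIcc hm)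
  have i2 := h1.mono_set (Set.uIcc_subset_uIcc hm Set.right_mem_uIcc)
  rw [h2, ← intervalIntegral.integral_add_adjacent_intervals i1 i2]
  have b1 : ∫ θ in (0 : ℝ)..δ, 2 * Real.exp (-h θ) ≤ ∫ _ in (0 : ℝ)..δ, 2 * Real.exp (-h δ) := by
    refine intervalIntegral.integral_mono_on_of_le_Ioo hδ.le i1 (by simp) fun θ hθ => ?_
    refine mul_le_mul_of_nonneg_left (Real.exp_le_exp.2 (neg_le_neg ?_)) (by norm_num)
    exact hh.anti ⟨hθ.1, by linarith [hθ.2]⟩ ⟨hδ, hδ'⟩ hθ.2.le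
  have b2 : ∫ θ in δ..(1 / 2), 2 * Real.exp (-h θ) ≤ ∫ _ in δ..(1 / 2), (2 : ℝ) := by
    refine intervalIntegral.integral_mono_on hδ' i2 (by simp) fun θ hθ => ?_
    have : Real.exp (-h θ) ≤ 1 :=
      Real.exp_le_one_iff.2 (neg_nonpos.2 (hh.nonneg _ ⟨hδ.trans_le hθ.1, hθ.2⟩))
    linarith
  rw [intervalIntegral.integral_const, smul_eq_mul] at b1 b2
  linarith

/-- The test polynomial 1 already has energy below 1, by an amount controlled by `h(δ) ≥ a` alone.
-/
lemma exists_uniform_lower_bound {a δ : ℝ} (ha : 0 < a) (hδ : 0 < δ) (hδ' : δ ≤ 1 / 2) :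
    ∃ l₀ : ℝ, 0 < l₀ ∧ ∀ h : ℝ → ℝ, IsDeepProfile h → a ≤ h δ → ∀ n,
      l₀ ≤ -Real.log (szegoError (deepZeroMeasure h) n) := by
  have he : Real.exp (-a) < 1 := Real.exp_lt_one_iff.2 (by linarith)
  set E := 1 - 2 * δ * (1 - Real.exp (-a)) with hE
  have hE1 : E < 1 := by
    have : 0 < 2 * δ * (1 - Real.exp (-a)) := mul_pos (by linarith) (by linarith)
    linarith
  have hE0 : 0 < E := by
    have := Real.exp_pos (-a)
    have : 2 * δ * (1 - Real.exp (-a)) < 1 := by nlinarith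
    linarith
  refine ⟨-(Real.log E / 2), by linarith [Real.log_neg hE0 hE1], fun h hh hah n => ?_⟩
  have h0 := (szegoError_pos_and_neg_log_le hh n (δ := 1 / 4) (by norm_num) le_rfl).1
  rw [neg_le_neg_iff, ← Real.log_sqrt hE0.le]
  refine Real.log_le_log h0 ?_
  refine (hh.szegoError_le_of_natDegree_le monic_one (by simp)).trans (Real.sqrt_le_sqrt ?_)
  refine (energy_one_le hh hδ hδ').trans ?_
  have : Real.exp (-h δ) ≤ Real.exp (-a) := Real.exp_le_exp.2 (by linarith)
  nlinarith

/-- Uniform two-sided bounds for large `n`, up to additive constants, suffice. -/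
lemma hasDeepZeroRate_of_eventually {g : ℝ → ℝ} {r : ℕ → ℝ}
    (hg : ∀ θ ∈ Set.Ioc (0 : ℝ) (1 / 2), 0 < g θ) (hr : ∀ n, 4 ≤ n → 0 < r n)
    (ht : Tendsto r atTop atTop)
    (HL : ∀ c δ : ℝ, 0 < c → 0 < δ → δ ≤ 1 / 2 → ∃ k B : ℝ, 0 < k ∧ ∀ᶠ n in atTop,
      ∀ h : ℝ → ℝ, IsDeepProfile h → (∀ θ ∈ Set.Ioc 0 δ, c * g θ ≤ h θ) →
        k * r n - B ≤ -Real.log (szegoError (deepZeroMeasure h) n))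
    (HU : ∀ C δ : ℝ, 0 < C → 0 < δ → δ ≤ 1 / 2 → ∃ K B : ℝ, ∀ᶠ n in atTop,
      ∀ h : ℝ → ℝ, IsDeepProfile h → (∀ θ ∈ Set.Ioc 0 δ, h θ ≤ C * g θ) →
        -Real.log (szegoError (deepZeroMeasure h) n) ≤ K * r n + B) :
    HasDeepZeroRate g r := by
  intro c C δ hc hC hδ hδ'
  obtain ⟨k₁, B₁, hk₁, h1⟩ := HL c δ hc hδ hδ'
  obtain ⟨K₁, B₂, h2⟩ := HU C δ hC hδ hδ'
  obtain ⟨N₀, hN₀⟩ := (h1.and h2).exists_forall_of_atTop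
  obtain ⟨l₀, hl₀, hl⟩ := exists_uniform_lower_bound (mul_pos hc (hg δ ⟨hδ, hδ'⟩)) hδ hδ'
  obtain ⟨k, K, hk, hK, H⟩ := exists_uniform_comparison hr ht (K₁ := K₁) (B := max B₁ B₂)
    (N₀ := N₀) hl₀ hk₁
  refine ⟨k, K, hk, hK, fun h ha hn hcomp n hn4 => ?_⟩
  have hh : IsDeepProfile h := ⟨ha, hn⟩
  have hpos : ∀ n, 0 < szegoError (deepZeroMeasure h) n := fun n =>
    (szegoError_pos_and_neg_log_le hh n (δ := 1 / 4) (by norm_num) le_rfl).1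
  have hL0 := hl h hh (hcomp δ ⟨hδ, le_rfl⟩).1
  have key := H (fun n => -Real.log (szegoError (deepZeroMeasure h) n))
    (fun m n hmn => neg_le_neg (Real.log_le_log (hpos n) (hh.szegoError_antitone hmn))) hL0
    (fun n hn => ⟨by
      have := (hN₀ n hn).1 h hh fun θ hθ => (hcomp θ hθ).1
      linarith [le_max_left B₁ B₂], by
      have := (hN₀ n hn).2 h hh fun θ hθ => (hcomp θ hθ).2
      linarith [le_max_right B₁ B₂]⟩) n hn4
  simp only
  rw [abs_of_neg (by linarith [hL0 n])]
  exact key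

/-! ### Bounds through a majorant; power and exponential profiles. -/

/-- The upper bound for `|log e_n|` in terms of a majorant of the profile. -/
lemma neg_log_szegoError_le_of_le {h : ℝ → ℝ} (hh : IsDeepProfile h) {g : ℝ → ℝ} {C δ : ℝ}
    (hδ : 0 < δ) (hδ' : δ ≤ 1 / 2) (hC : ∀ θ ∈ Set.Ioc 0 δ, h θ ≤ C * g θ) (n : ℕ) {η : ℝ}
    (hη : 0 < η) (hη4 : η ≤ 1 / 4) (hηδ : η ≤ δ) (hg : IntervalIntegrable g volume η δ) :
    -Real.log (szegoError (deepZeroMeasure h) n) ≤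
      3 + C * (η * g η) + 9 * (n * η ^ 2) + (C * (∫ θ in η..δ, g θ) + C * g δ) := by
  refine (szegoError_pos_and_neg_log_le hh n hη hη4).2.trans ?_
  have i1 := hh.intervalIntegrable hη (by linarith)
  have hm : δ ∈ Set.uIcc η (1 / 2) := by
    rw [Set.uIcc_of_le (by linarith)]; exact ⟨hηδ, hδ'⟩
  have i2 := i1.mono_set (Set.uIcc_subset_uIcc Set.left_mem_uIcc hm)
  have i3 := i1.mono_set (Set.uIcc_subset_uIcc hm Set.right_mem_uIcc)
  have b1 : ∫ θ in η..δ, h θ ≤ C * ∫ θ in η..δ, g θ := by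
    rw [← intervalIntegral.integral_const_mul]
    exact intervalIntegral.integral_mono_on hηδ i2 (hg.const_mul C)
      fun θ hθ => hC θ ⟨hη.trans_le hθ.1, hθ.2⟩
  have hδm : δ ∈ Set.Ioc (0 : ℝ) (1 / 2) := ⟨hδ, hδ'⟩
  have b2 : ∫ θ in δ..(1 / 2), h θ ≤ ∫ _ in δ..(1 / 2), h δ :=
    intervalIntegral.integral_mono_on hδ' i3 (by simp)
      fun θ hθ => hh.anti hδm ⟨hδ.trans_le hθ.1, hθ.2⟩ hθ.1
  rw [intervalIntegral.integral_const, smul_eq_mul] at b2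
  have b3 := hC δ ⟨hδ, le_rfl⟩
  have b4 := hC η ⟨hη, hηδ⟩
  have b5 := hh.nonneg δ hδm
  have b6 : η * h η ≤ C * (η * g η) := by
    have := mul_le_mul_of_nonneg_left b4 hη.le
    linarith
  rw [← intervalIntegral.integral_add_adjacent_intervals i2 i3]
  nlinarith

/-- The scale `η ≍ n^{-1/(p+1)}` balances `n η²` against `η h(η)`; as `p > 1`, `∫_η h` has the same
order. -/
lemma hasDeepZeroRate_rpow {p : ℝ} (hp : 1 < p) :
    HasDeepZeroRate (fun θ => θ ^ (-p)) (fun n => (n : ℝ) ^ ((p - 1) / (p + 1))) := by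
  have hp1 : 0 < p + 1 := by linarith
  have hexp : 0 < (p - 1) / (p + 1) := div_pos (by linarith) hp1
  have hnat : Tendsto (fun n : ℕ => (n : ℝ)) atTop atTop := tendsto_natCast_atTop_atTop
  have hsmall : Tendsto (fun n : ℕ => (n : ℝ) ^ (-(1 / (p + 1)))) atTop (nhds 0) :=
    (tendsto_rpow_neg_atTop (by positivity)).comp hnat
  have hsq : ∀ n : ℕ, 0 < n → (n : ℝ) * ((n : ℝ) ^ (-(1 / (p + 1)))) ^ 2 =
      (n : ℝ) ^ ((p - 1) / (p + 1)) := fun n hn => by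
    have hn' : (0 : ℝ) < n := Nat.cast_pos.2 hn
    rw [← Real.rpow_natCast, ← Real.rpow_mul hn'.le]
    nth_rewrite 1 [← Real.rpow_one (n : ℝ)]
    rw [← Real.rpow_add hn']
    congr 1
    push_cast
    field_simp
    ring
  refine hasDeepZeroRate_of_eventually (fun θ hθ => Real.rpow_pos_of_pos hθ.1 _)
    (fun n hn => Real.rpow_pos_of_pos (by positivity) _)
    ((tendsto_rpow_atTop hexp).comp hnat) ?_ ?_
  · intro c δ hc hδ hδ'
    -- Chosen so that `c η^{-p} = 10 n η` at `η = a ν`, the threshold of the gap lemma.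
    set a : ℝ := (c / 10) ^ (1 / (p + 1)) with ha
    have ha0 : 0 < a := Real.rpow_pos_of_pos (by positivity) _
    have hap : a ^ (p + 1) = c / 10 := by
      rw [ha, ← Real.rpow_mul (by positivity), one_div_mul_cancel hp1.ne', Real.rpow_one]
    refine ⟨2 * a ^ 2, 3, by positivity, ?_⟩
    have hsm := hsmall.const_mul a
    rw [mul_zero] at hsm
    filter_upwards [hsm.eventually_le_const (u := min δ (1 / 4)) (by positivity),
      eventually_gt_atTop 0] with n h1 hn h hh hgh
    have hn' : (0 : ℝ) < n := Nat.cast_pos.2 hn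
    set ν := (n : ℝ) ^ (-(1 / (p + 1))) with hν
    have hν0 : 0 < ν := Real.rpow_pos_of_pos hn' _
    have hνp : ν ^ (p + 1) = (n : ℝ)⁻¹ := by
      rw [hν, ← Real.rpow_mul hn'.le, neg_mul, one_div_mul_cancel hp1.ne', Real.rpow_neg_one]
    have hη := mul_pos ha0 hν0
    have hle := hgh (a * ν) ⟨hη, h1.trans (min_le_left _ _)⟩
    have key := le_neg_log_szegoError_of_gap hh (n := n) hη (h1.trans (min_le_right _ _)) ?_
    · rw [mul_pow] at key
      rw [← hsq n hn]
      linarith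
    · refine le_trans (le_of_eq ?_) hle
      have e : (a * ν) ^ (-p) = (a * ν) * ((a * ν) ^ (p + 1))⁻¹ := by
        rw [← Real.rpow_neg hη.le]
        nth_rewrite 2 [← Real.rpow_one (a * ν)]
        rw [← Real.rpow_add hη]
        congr 1
        ring
      rw [e, Real.mul_rpow ha0.le hν0.le, hap, hνp]
      field_simp
  · intro C δ hC hδ hδ'
    refine ⟨C + 9 + C * (1 / (p - 1)), 3 + C * δ ^ (-p), ?_⟩
    filter_upwards [hsmall.eventually_le_const (u := min δ (1 / 4)) (by positivity),
      eventually_gt_atTop 0] with n h1 hn h hh hgh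
    have hn' : (0 : ℝ) < n := Nat.cast_pos.2 hn
    set ν := (n : ℝ) ^ (-(1 / (p + 1))) with hν
    have hν0 : 0 < ν := Real.rpow_pos_of_pos hn' _
    have hνδ : ν ≤ δ := h1.trans (min_le_left _ _)
    have h0 : (0 : ℝ) ∉ Set.uIcc ν δ := by
      rw [Set.uIcc_of_le hνδ]
      exact fun h => absurd h.1 (not_le.2 hν0)
    have key := neg_log_szegoError_le_of_le hh hδ hδ' hgh n hν0 (h1.trans (min_le_right _ _)) hνδ
      (intervalIntegral.intervalIntegrable_rpow (Or.inr h0))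
    refine key.trans ?_
    have hr : ν ^ (1 - p) = (n : ℝ) ^ ((p - 1) / (p + 1)) := by
      rw [hν, ← Real.rpow_mul hn'.le]
      congr 1
      field_simp
      ring
    have e1 : ν * ν ^ (-p) = (n : ℝ) ^ ((p - 1) / (p + 1)) := by
      rw [← hr, sub_eq_add_neg, Real.rpow_add hν0, Real.rpow_one]
    have e2 : ∫ θ in ν..δ, θ ^ (-p) ≤ 1 / (p - 1) * (n : ℝ) ^ ((p - 1) / (p + 1)) := by
      rw [integral_rpow (Or.inr ⟨by linarith, h0⟩), ← hr, show -p + 1 = 1 - p by ring,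
        div_eq_mul_inv, show (1 - p)⁻¹ = -(1 / (p - 1)) by
          rw [one_div, ← inv_neg, neg_sub]]
      have := Real.rpow_pos_of_pos hδ (1 - p)
      have : 0 < 1 / (p - 1) := by apply one_div_pos.2; linarith
      nlinarith
    rw [e1, hsq n hn]
    nlinarith

/-- At `η = (b log n)^{-1/p}` the model profile equals `n^b`. Taking `b = 2` puts `h(η)` above `10 n
η`; taking `b = 1/2` makes all terms containing `h` at most of order `√n`, negligible against `n
η²`. The value of `b` changes only constants. -/
lemma hasDeepZeroRate_exp_rpow {p : ℝ} (hp : 0 < p) :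
    HasDeepZeroRate (fun θ => Real.exp (θ ^ (-p)))
      (fun n => (n : ℝ) * Real.log (n : ℝ) ^ (-2 / p)) := by
  have hnat : Tendsto (fun n : ℕ => (n : ℝ)) atTop atTop := tendsto_natCast_atTop_atTop
  have hlog : Tendsto (fun n : ℕ => Real.log (n : ℝ)) atTop atTop :=
    Real.tendsto_log_atTop.comp hnat
  have hscale : ∀ b : ℝ, 0 < b →
      Tendsto (fun n : ℕ => (b * Real.log (n : ℝ)) ^ (-(1 / p))) atTop (nhds 0) := fun b hb =>
    (tendsto_rpow_neg_atTop (by positivity)).comp (hlog.const_mul_atTop hb)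
  have hsq : ∀ b : ℝ, 0 < b → ∀ n : ℕ, 0 < Real.log (n : ℝ) →
      (n : ℝ) * ((b * Real.log (n : ℝ)) ^ (-(1 / p))) ^ 2 =
        b ^ (-2 / p) * ((n : ℝ) * Real.log (n : ℝ) ^ (-2 / p)) := fun b hb n hn => by
    rw [← Real.rpow_natCast, ← Real.rpow_mul (by positivity), Real.mul_rpow hb.le hn.le,
      show -(1 / p) * ((2 : ℕ) : ℝ) = -2 / p by push_cast; ring]
    ring
  have hpow : ∀ b : ℝ, 0 < b → ∀ n : ℕ, 0 < n → 0 < Real.log (n : ℝ) →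
      Real.exp (((b * Real.log (n : ℝ)) ^ (-(1 / p))) ^ (-p)) = (n : ℝ) ^ b := fun b hb n hn hl => by
    rw [← Real.rpow_mul (by positivity), neg_mul_neg, one_div_mul_cancel hp.ne', Real.rpow_one,
      Real.rpow_def_of_pos (Nat.cast_pos.2 hn), mul_comm]
  have hsmallo : ∀ᶠ x : ℝ in atTop, x ^ (1 / 2 : ℝ) ≤ x * Real.log x ^ (-2 / p) := by
    have h1 := (isLittleO_log_rpow_rpow_atTop (2 / p) (s := 1 / 2) (by norm_num)).bound
      (c := 1) one_pos
    filter_upwards [h1, eventually_gt_atTop 1] with x hx hx1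
    have hl : 0 < Real.log x := Real.log_pos hx1
    have hx0 : 0 < x := by linarith
    rw [Real.norm_of_nonneg (by positivity), Real.norm_of_nonneg (by positivity), one_mul] at hx
    rw [neg_div, Real.rpow_neg hl.le, ← div_eq_mul_inv, le_div_iff₀ (by positivity)]
    calc x ^ (1 / 2 : ℝ) * Real.log x ^ (2 / p) ≤ x ^ (1 / 2 : ℝ) * x ^ (1 / 2 : ℝ) :=
          mul_le_mul_of_nonneg_left hx (by positivity)
      _ = x := by rw [← Real.rpow_add hx0]; norm_num
  have hsmallN : ∀ᶠ n : ℕ in atTop,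
      (n : ℝ) ^ (1 / 2 : ℝ) ≤ (n : ℝ) * Real.log n ^ (-2 / p) := hnat.eventually hsmallo
  refine hasDeepZeroRate_of_eventually (fun θ hθ => Real.exp_pos _)
    (fun n hn => mul_pos (by positivity) (Real.rpow_pos_of_pos (Real.log_pos (by
      exact_mod_cast (by omega : 1 < n))) _)) ?_ ?_ ?_
  · exact tendsto_atTop_mono' _ hsmallN ((tendsto_rpow_atTop (by norm_num)).comp hnat)
  · intro c δ hc hδ hδ'
    refine ⟨2 * 2 ^ (-2 / p), 3, by positivity, ?_⟩
    filter_upwards [(hscale 2 two_pos).eventually_le_const (u := min δ (1 / 4)) (by positivity),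
      eventually_gt_atTop 0, hlog.eventually_gt_atTop 0, hnat.eventually_ge_atTop (10 / c)]
      with n h1 hn hl hnc h hh hgh
    have hn' : (0 : ℝ) < n := Nat.cast_pos.2 hn
    have hη : 0 < (2 * Real.log (n : ℝ)) ^ (-(1 / p)) := Real.rpow_pos_of_pos (by positivity) _
    have hle := hgh _ ⟨hη, h1.trans (min_le_left _ _)⟩
    have key := le_neg_log_szegoError_of_gap hh (n := n) hη (h1.trans (min_le_right _ _)) ?_
    · rw [hsq 2 two_pos n hl] at key
      linarith
    · refine le_trans ?_ hle
      rw [hpow 2 two_pos n hn hl]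
      have h4 : (2 * Real.log (n : ℝ)) ^ (-(1 / p)) ≤ 1 := by
        linarith [min_le_right δ (1 / 4)]
      have e : (n : ℝ) ^ (2 : ℝ) = n * n := by
        rw [← sq, ← Real.rpow_natCast]; norm_num
      rw [div_le_iff₀ hc] at hnc
      rw [e]
      have := mul_le_mul_of_nonneg_left h4 hn'.le
      nlinarith
  · intro C δ hC hδ hδ'
    refine ⟨2 * C + 9 * (1 / 2) ^ (-2 / p), 3 + C * Real.exp (δ ^ (-p)), ?_⟩
    filter_upwards [(hscale (1 / 2) (by norm_num)).eventually_le_const (u := min δ (1 / 4))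
      (by positivity), eventually_gt_atTop 0, hlog.eventually_gt_atTop 0, hsmallN]
      with n h1 hn hl hsm h hh hgh
    have hn' : (0 : ℝ) < n := Nat.cast_pos.2 hn
    have hη : 0 < (1 / 2 * Real.log (n : ℝ)) ^ (-(1 / p)) := Real.rpow_pos_of_pos (by positivity) _
    have hq := hpow (1 / 2) (by norm_num) n hn hl
    have hs := hsq (1 / 2) (by norm_num) n hl
    set η := (1 / 2 * Real.log (n : ℝ)) ^ (-(1 / p))
    have hηδ : η ≤ δ := h1.trans (min_le_left _ _)
    have hη4 : η ≤ 1 / 4 := h1.trans (min_le_right _ _)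
    have hanti : AntitoneOn (fun θ : ℝ => Real.exp (θ ^ (-p))) (Set.Icc η δ) := fun x hx y hy hxy =>
      Real.exp_le_exp.2 (Real.rpow_le_rpow_of_nonpos (hη.trans_le hx.1) hxy (by linarith))
    have hint : IntervalIntegrable (fun θ : ℝ => Real.exp (θ ^ (-p))) volume η δ := by
      refine AntitoneOn.intervalIntegrable ?_
      rwa [Set.uIcc_of_le hηδ]
    have key := neg_log_szegoError_le_of_le hh hδ hδ' hgh n hη hη4 hηδ hint
    refine key.trans ?_
    have b1 : ∫ θ in η..δ, Real.exp (θ ^ (-p)) ≤ ∫ _ in η..δ, Real.exp (η ^ (-p)) :=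
      intervalIntegral.integral_mono_on hηδ hint (by simp)
        fun θ hθ => hanti ⟨le_rfl, hηδ⟩ hθ hθ.1
    rw [intervalIntegral.integral_const, smul_eq_mul, hq] at b1
    have hn2 : 0 ≤ (n : ℝ) ^ (1 / 2 : ℝ) := by positivity
    have b2 : ∫ θ in η..δ, Real.exp (θ ^ (-p)) ≤ (n : ℝ) ^ (1 / 2 : ℝ) := by nlinarith
    have b3 : η * (n : ℝ) ^ (1 / 2 : ℝ) ≤ (n : ℝ) ^ (1 / 2 : ℝ) :=
      mul_le_of_le_one_left hn2 (by linarith)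
    rw [hq, hs]
    have b4 := mul_le_mul_of_nonneg_left (b2.trans hsm) hC.le
    have b5 := mul_le_mul_of_nonneg_left (b3.trans hsm) hC.le
    linarith

/-! ### Profiles comparable to `θ⁻¹ log^p (1/θ)`. -/

lemma rpow_le_pow_mul_rpow {p : ℝ} {m : ℕ} (hm : |p| ≤ m) {x y M : ℝ} (hx : 0 < x) (hy : 0 < y)
    (hM : 1 ≤ M) (hxy : x ≤ M * y) (hyx : y ≤ M * x) : x ^ p ≤ M ^ m * y ^ p := by
  have hM0 : 0 < M := by linarith
  have key : (x / y) ^ p ≤ M ^ |p| := by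
    rcases le_total 0 p with h | h
    · rw [abs_of_nonneg h]
      exact Real.rpow_le_rpow (by positivity) ((div_le_iff₀ hy).2 hxy) h
    · rw [abs_of_nonpos h, ← inv_div, Real.inv_rpow (by positivity), ← Real.rpow_neg (by positivity)]
      exact Real.rpow_le_rpow (by positivity) ((div_le_iff₀ hx).2 hyx) (by linarith)
  have h2 : M ^ |p| ≤ M ^ m := by
    rw [← Real.rpow_natCast]
    exact Real.rpow_le_rpow_of_exponent_le hM hm
  rw [Real.div_rpow hx.le hy.le, div_le_iff₀ (Real.rpow_pos_of_pos hy p)] at key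
  exact key.trans (mul_le_mul_of_nonneg_right h2 (Real.rpow_nonneg hy.le p))

/-- With truncated subtraction `(k - j) + (j - k)` is `|k - j|`, and each distance is attained at
most twice. -/
lemma sum_dist_le {u : ℕ → ℝ} (hu : Summable u) (hu0 : ∀ i, 0 ≤ u i) (s : Finset ℕ) (j : ℕ) :
    ∑ k ∈ s, u ((k - j) + (j - k)) ≤ 2 * ∑' i, u i := by
  have hinj : ∀ (t : Finset ℕ) (φ : ℕ → ℕ), Set.InjOn φ t → ∑ k ∈ t, u (φ k) ≤ ∑' i, u i :=
    fun t φ hφ => by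
      rw [← Finset.sum_image (f := u) hφ]
      exact hu.sum_le_tsum _ fun i _ => hu0 i
  rw [← Finset.sum_filter_add_sum_filter_not s (fun k => k ≤ j), two_mul]
  refine add_le_add (hinj _ _ ?_) (hinj _ _ ?_)
  · intro a ha b hb hab
    simp only [Finset.coe_filter, Set.mem_ofPred_eq] at ha hb hab
    omega
  · intro a ha b hb hab
    simp only [Finset.coe_filter, Set.mem_ofPred_eq] at ha hb hab
    omega

lemma summable_one_add_pow_mul_geometric (m : ℕ) :
    Summable fun i : ℕ => (1 + (i : ℝ)) ^ m * (1 / 2) ^ i := by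
  have h1 := summable_pow_mul_geometric_of_norm_lt_one (R := ℝ) m (r := 1 / 2) (by norm_num)
  have h2 := ((summable_nat_add_iff 1).2 h1).mul_left 2
  refine h2.congr fun i => ?_
  push_cast
  rw [pow_succ]
  ring

/-- Dyadic sums of Fejér type bounds with weights `k^p` are at most of order
`θ⁻¹ log^p (1/θ)`. -/
lemma exists_sum_rpow_mul_min_le (p : ℝ) : ∃ A : ℝ, 0 < A ∧ ∀ θ ∈ Set.Ioc (0 : ℝ) (1 / 2), ∀ K : ℕ,
    ∑ k ∈ Finset.Icc 1 K, (k : ℝ) ^ p * min ((2 : ℝ) ^ k) (1 / (4 * 2 ^ k * θ ^ 2)) ≤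
      A * (θ⁻¹ * Real.log (1 / θ) ^ p) := by
  obtain ⟨m, hm⟩ := exists_nat_ge |p|
  set u : ℕ → ℝ := fun i => (1 + (i : ℝ)) ^ m * (1 / 2) ^ i with hu
  have hus : Summable u := summable_one_add_pow_mul_geometric m
  have hu0 : ∀ i, 0 ≤ u i := fun i => by positivity
  have hU : 0 ≤ ∑' i, u i := tsum_nonneg hu0
  refine ⟨2 * (∑' i, u i) * 2 ^ m + 1, by positivity, fun θ hθ K => ?_⟩
  have hθ0 := hθ.1
  have hx : 2 ≤ 1 / θ := by
    rw [le_div_iff₀ hθ0]; linarith [hθ.2]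
  -- `2^j` is the dyadic size of `1/θ`. The `k`-th kernel loses a factor `2^{-|k-j|}` on either side
  -- of `j`, while replacing `k^p` by `j^p` costs only `(1 + |k-j|)^m`.
  obtain ⟨j, hj1, hj2⟩ := exists_nat_pow_near (by linarith : 1 ≤ 1 / θ) (one_lt_two)
  have hj0 : 0 < j := by
    rcases Nat.eq_zero_or_pos j with rfl | h
    · norm_num at hj2; norm_num at hx; linarith
    · exact h
  have hjR : (1 : ℝ) ≤ j := by exact_mod_cast hj0
  have hterm : ∀ k ∈ Finset.Icc 1 K,
      (k : ℝ) ^ p * min ((2 : ℝ) ^ k) (1 / (4 * 2 ^ k * θ ^ 2)) ≤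
        2 ^ j * (j : ℝ) ^ p * u ((k - j) + (j - k)) := by
    intro k hk
    have hk0 : 0 < k := (Finset.mem_Icc.1 hk).1
    have hkR : (1 : ℝ) ≤ k := by exact_mod_cast hk0
    set i := (k - j) + (j - k) with hi
    have h1 : (k : ℝ) ^ p ≤ (1 + (i : ℝ)) ^ m * (j : ℝ) ^ p := by
      have hi0 : (0 : ℝ) ≤ i := Nat.cast_nonneg i
      have a1 : (k : ℝ) ≤ j + i := by exact_mod_cast (by omega : k ≤ j + i)
      have a2 : (j : ℝ) ≤ k + i := by exact_mod_cast (by omega : j ≤ k + i)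
      exact rpow_le_pow_mul_rpow hm (by linarith) (by linarith) (by linarith)
        (by nlinarith) (by nlinarith)
    have h2 : min ((2 : ℝ) ^ k) (1 / (4 * 2 ^ k * θ ^ 2)) ≤ 2 ^ j * (1 / 2) ^ i := by
      rcases le_total k j with h | h
      · refine (min_le_left _ _).trans (le_of_eq ?_)
        have : i = j - k := by omega
        rw [this, one_div, inv_pow, ← div_eq_mul_inv, eq_div_iff (by positivity), ← pow_add]
        congr 1
        omega
      · refine (min_le_right _ _).trans ?_
        have h3 : (1 / θ) ^ 2 ≤ 4 * (2 ^ j) ^ 2 := by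
          have := pow_le_pow_left₀ (by positivity) hj2.le 2
          rw [pow_succ (2 : ℝ) j, mul_pow (2 ^ j : ℝ)] at this
          linarith
        have h4 : (2 : ℝ) ^ k = 2 ^ j * 2 ^ i := by
          rw [← pow_add]; congr 1; omega
        have h5 : 1 / (4 * 2 ^ k * θ ^ 2) = (1 / θ) ^ 2 / (4 * 2 ^ k) := by
          field_simp
        rw [h5, h4, div_le_iff₀ (by positivity)]
        have h6 : (2 : ℝ) ^ j * (1 / 2) ^ i * (4 * (2 ^ j * 2 ^ i)) =
            4 * (2 ^ j) ^ 2 * ((1 / 2) ^ i * 2 ^ i) := by ring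
        rw [h6, ← mul_pow]
        norm_num
        norm_num at h3
        exact h3
    calc _ ≤ ((1 + (i : ℝ)) ^ m * (j : ℝ) ^ p) * (2 ^ j * (1 / 2) ^ i) :=
          mul_le_mul h1 h2 (by positivity) (by positivity)
      _ = _ := by rw [hu]; ring
  refine (Finset.sum_le_sum hterm).trans ?_
  rw [← Finset.mul_sum]
  have hl2 : 0.69 < Real.log 2 := by linarith [Real.log_two_gt_d9]
  have hl2' : Real.log 2 < 0.7 := by linarith [Real.log_two_lt_d9]
  have hℓ1 : j * Real.log 2 ≤ Real.log (1 / θ) := by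
    rw [← Real.log_pow]; exact Real.log_le_log (by positivity) hj1
  have hℓ2 : Real.log (1 / θ) ≤ (j + 1) * Real.log 2 := by
    have := Real.log_le_log (by positivity) hj2.le
    rw [Real.log_pow] at this
    exact_mod_cast this
  have hℓ0 : 0 < Real.log (1 / θ) := Real.log_pos (by linarith)
  have h7 : (j : ℝ) ^ p ≤ 2 ^ m * Real.log (1 / θ) ^ p :=
    rpow_le_pow_mul_rpow hm (by linarith) hℓ0 (by norm_num) (by nlinarith) (by nlinarith)
  rw [one_div] at hj1
  have hlp : 0 < Real.log (1 / θ) ^ p := Real.rpow_pos_of_pos hℓ0 _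
  calc _ ≤ (θ⁻¹ * (2 ^ m * Real.log (1 / θ) ^ p)) * (2 * ∑' i, u i) :=
        mul_le_mul (mul_le_mul hj1 h7 (by positivity) (by positivity)) (sum_dist_le hus hu0 _ _)
          (Finset.sum_nonneg fun _ _ => hu0 _) (by positivity)
    _ = 2 * (∑' i, u i) * 2 ^ m * (θ⁻¹ * Real.log (1 / θ) ^ p) := by ring
    _ ≤ _ := mul_le_mul_of_nonneg_right (by linarith) (by positivity)

/-- The ratio 2 is raised to `5/2` to absorb `k^p`, and `(5/2)² ≤ 8` still holds. -/
lemma exists_sum_rpow_mul_two_pow_sq_le (p : ℝ) : ∃ B : ℝ, ∀ K : ℕ,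
    (∑ k ∈ Finset.Icc 1 K, (k : ℝ) ^ p * 2 ^ k) ^ 2 ≤ B * ((8 ^ K : ℕ) : ℝ) := by
  obtain ⟨m, hm⟩ := exists_nat_ge |p|
  have hs := summable_pow_mul_geometric_of_norm_lt_one (R := ℝ) m (r := 4 / 5) (by norm_num)
  set T := ∑' i : ℕ, (i : ℝ) ^ m * (4 / 5) ^ i
  have hT0 : 0 ≤ T := tsum_nonneg fun i => by positivity
  have hT : ∀ k : ℕ, (k : ℝ) ^ m * (4 / 5) ^ k ≤ T := fun k =>
    hs.le_tsum k fun i _ => by positivity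
  have hterm : ∀ k : ℕ, 1 ≤ k → (k : ℝ) ^ p * 2 ^ k ≤ T * (5 / 2) ^ k := fun k hk => by
    have hk1 : (1 : ℝ) ≤ k := by exact_mod_cast hk
    have h1 : (k : ℝ) ^ p ≤ (k : ℝ) ^ m := by
      rw [← Real.rpow_natCast]
      exact Real.rpow_le_rpow_of_exponent_le hk1 ((le_abs_self p).trans hm)
    calc (k : ℝ) ^ p * 2 ^ k ≤ (k : ℝ) ^ m * 2 ^ k := mul_le_mul_of_nonneg_right h1 (by positivity)
      _ = (k : ℝ) ^ m * (4 / 5) ^ k * (5 / 2) ^ k := by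
          rw [mul_assoc, ← mul_pow]; norm_num
      _ ≤ _ := mul_le_mul_of_nonneg_right (hT k) (by positivity)
  have hsum : ∀ K : ℕ, ∑ k ∈ Finset.Icc 1 K, (k : ℝ) ^ p * 2 ^ k ≤ T * (2 * (5 / 2) ^ K) := by
    intro K
    induction K with
    | zero => simp; positivity
    | succ K ih =>
      rw [Finset.sum_Icc_succ_top (by omega)]
      have := hterm (K + 1) (by omega)
      rw [pow_succ (5 / 2 : ℝ)] at this ⊢
      have h5 : 0 ≤ T * (5 / 2 : ℝ) ^ K := by positivity
      nlinarith
  refine ⟨4 * T ^ 2, fun K => ?_⟩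
  have h0 : 0 ≤ ∑ k ∈ Finset.Icc 1 K, (k : ℝ) ^ p * 2 ^ k :=
    Finset.sum_nonneg fun k _ => by positivity
  refine (pow_le_pow_left₀ h0 (hsum K) 2).trans ?_
  have e : (T * (2 * (5 / 2) ^ K)) ^ 2 = 4 * T ^ 2 * (25 / 4 : ℝ) ^ K := by
    rw [mul_pow, mul_pow, ← pow_mul, mul_comm K 2, pow_mul]; norm_num; ring
  rw [e]
  push_cast
  exact mul_le_mul_of_nonneg_left (pow_le_pow_left₀ (by norm_num) (by norm_num) K) (by positivity)

/-- Fejér weights `ε k^p` with `N = 8^K`: the degree is at most `16^K ≤ n` for `K = ⌊log₂ n⌋ / 4`,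
and `ε` makes the kernel sum at most `h/2` on `(0, δ]`. -/
lemma exists_lower_bound_log (p : ℝ) {c δ : ℝ} (hc : 0 < c) (hδ : 0 < δ) (hδ' : δ ≤ 1 / 2) :
    ∃ ε B : ℝ, 0 < ε ∧ ∀ n : ℕ, 0 < n → ∀ h : ℝ → ℝ, IsDeepProfile h →
      (∀ θ ∈ Set.Ioc 0 δ, c * (θ⁻¹ * Real.log (1 / θ) ^ p) ≤ h θ) →
        ε * ∑ k ∈ Finset.Icc 1 (Nat.log 2 n / 4), (k : ℝ) ^ p - B ≤
          -Real.log (szegoError (deepZeroMeasure h) n) := by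
  obtain ⟨A, hA, hAs⟩ := exists_sum_rpow_mul_min_le p
  obtain ⟨B, hB⟩ := exists_sum_rpow_mul_two_pow_sq_le p
  set ε := c / (2 * A) with hε
  have hε0 : 0 < ε := by positivity
  have hεA : ε * A = c / 2 := by rw [hε]; field_simp
  set G := δ⁻¹ * Real.log (1 / δ) ^ p with hG
  have hlog : ∀ θ ∈ Set.Ioc (0 : ℝ) (1 / 2), 0 < Real.log (1 / θ) := fun θ hθ =>
    Real.log_pos (by rw [lt_div_iff₀ hθ.1]; linarith [hθ.2])
  have hG0 : 0 < G := by
    have := hlog δ ⟨hδ, hδ'⟩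
    positivity
  refine ⟨ε, c / 2 * G + ε ^ 2 * B, hε0, fun n hn h hh hgh => ?_⟩
  set K := Nat.log 2 n / 4 with hK
  have hdeg : 8 ^ K * 2 ^ K ≤ n := by
    rw [← mul_pow]
    calc (8 * 2) ^ K = 2 ^ (4 * K) := by rw [pow_mul]; norm_num
      _ ≤ 2 ^ Nat.log 2 n := Nat.pow_le_pow_right (by norm_num) (by omega)
      _ ≤ n := Nat.pow_log_le_self 2 hn.ne'
  have key := le_neg_log_szegoError_of_fejer_sum hh (N := 8 ^ K) (by positivity) hdeg
    (b := fun k => ε * (k : ℝ) ^ p) (fun k => by positivity) (C₁ := c / 2 * G)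
    (C₂ := ε ^ 2 * B) ?_ ?_
  · rw [Finset.mul_sum]
    linarith
  · intro θ hθ
    simp only [mul_assoc]
    rw [← Finset.mul_sum]
    simp only [← mul_assoc]
    rcases le_total θ δ with h1 | h1
    · have h2 := mul_le_mul_of_nonneg_left (hAs θ hθ K) hε0.le
      have h3 := hgh θ ⟨hθ.1, h1⟩
      rw [← mul_assoc, hεA] at h2
      have : 0 ≤ c / 2 * G := by positivity
      linarith
    -- Beyond `δ` only `h ≥ 0` is available; the kernel bounds decrease in `θ`, so the value at `δ`
    -- serves as the constant `C₁`.
    · have h2 := mul_le_mul_of_nonneg_left (hAs δ ⟨hδ, hδ'⟩ K) hε0.le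
      rw [← mul_assoc, hεA] at h2
      have h3 := hh.nonneg θ hθ
      refine le_trans ?_ (h2.trans (by linarith))
      refine mul_le_mul_of_nonneg_left (Finset.sum_le_sum fun k _ => ?_) hε0.le
      refine mul_le_mul_of_nonneg_left (min_le_min le_rfl ?_) (by positivity)
      exact one_div_le_one_div_of_le (by positivity)
        (mul_le_mul_of_nonneg_left (pow_le_pow_left₀ hδ.le h1 2) (by positivity))
  · simp only [mul_assoc]
    rw [← Finset.mul_sum, mul_pow]
    exact mul_le_mul_of_nonneg_left (hB K) (by positivity)

/-- Leaving the primitive `G` of `x^p` abstract treats `p > -1` and `p = -1` together. At `η =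
n^{-1/2}` one has `n η² = 1`, and `∫_η` of the model profile is `G(log n / 2)` up to a constant. -/
lemma hasDeepZeroRate_inv_mul_log_rpow {p : ℝ} {G : ℝ → ℝ} {r : ℕ → ℝ}
    (hr : ∀ n, 4 ≤ n → 0 < r n) (ht : Tendsto r atTop atTop)
    (hG : ∀ x, 0 < x → HasDerivAt G (x ^ p) x) {k₀ K₀ B₀ : ℝ} (hk₀ : 0 < k₀)
    (h1 : ∀ᶠ n : ℕ in atTop, (Real.log n / 2) ^ p ≤ K₀ * r n + B₀)
    (h2 : ∀ᶠ n : ℕ in atTop, G (Real.log n / 2) ≤ K₀ * r n + B₀)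
    (h3 : ∀ᶠ n : ℕ in atTop, k₀ * r n - B₀ ≤
      ∑ k ∈ Finset.Icc 1 (Nat.log 2 n / 4), (k : ℝ) ^ p) :
    HasDeepZeroRate (fun θ => θ⁻¹ * Real.log (1 / θ) ^ p) r := by
  have hlog : ∀ θ : ℝ, 0 < θ → θ ≤ 1 / 2 → 0 < Real.log (1 / θ) := fun θ h h' =>
    Real.log_pos (by rw [lt_div_iff₀ h]; linarith)
  refine hasDeepZeroRate_of_eventually (fun θ hθ => mul_pos (inv_pos.2 hθ.1)
    (Real.rpow_pos_of_pos (hlog θ hθ.1 hθ.2) _)) hr ht ?_ ?_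
  · intro c δ hc hδ hδ'
    obtain ⟨ε, B, hε, H⟩ := exists_lower_bound_log p hc hδ hδ'
    refine ⟨ε * k₀, ε * B₀ + B, by positivity, ?_⟩
    filter_upwards [h3, eventually_gt_atTop 0] with n hn hn0 h hh hgh
    have := mul_le_mul_of_nonneg_left hn hε.le
    linarith [H n hn0 h hh hgh]
  · intro C δ hC hδ hδ'
    refine ⟨2 * C * K₀, 12 + 2 * C * B₀ - C * G (Real.log (1 / δ)) +
      C * (δ⁻¹ * Real.log (1 / δ) ^ p), ?_⟩
    have hsmall : Tendsto (fun n : ℕ => (n : ℝ) ^ (-(1 / 2 : ℝ))) atTop (nhds 0) :=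
      (tendsto_rpow_neg_atTop (by norm_num)).comp tendsto_natCast_atTop_atTop
    filter_upwards [h1, h2, hsmall.eventually_le_const (u := min δ (1 / 4)) (by positivity),
      eventually_gt_atTop 0] with n hn1 hn2 hn3 hn h hh hgh
    have hn' : (0 : ℝ) < n := Nat.cast_pos.2 hn
    set η := (n : ℝ) ^ (-(1 / 2 : ℝ)) with hη'
    have hη : 0 < η := Real.rpow_pos_of_pos hn' _
    have hηδ : η ≤ δ := hn3.trans (min_le_left _ _)
    have hlogη : Real.log (1 / η) = Real.log n / 2 := by
      rw [one_div, Real.log_inv, hη', Real.log_rpow hn']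
      ring
    have hcont : ContinuousOn (fun θ : ℝ => θ⁻¹ * Real.log (1 / θ) ^ p) (Set.uIcc η δ) := by
      rw [Set.uIcc_of_le hηδ]
      intro θ hθ
      have hθ0 : 0 < θ := hη.trans_le hθ.1
      have := hlog θ hθ0 (hθ.2.trans hδ')
      refine ContinuousAt.continuousWithinAt ?_
      refine (continuousAt_inv₀ hθ0.ne').mul (ContinuousAt.rpow_const ?_ (Or.inl this.ne'))
      exact ContinuousAt.log (continuousAt_const.div continuousAt_id hθ0.ne') (by positivity)
    have key := neg_log_szegoError_le_of_le hh hδ hδ' hgh n hη (hn3.trans (min_le_right _ _)) hηδ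
      hcont.intervalIntegrable
    have hint : ∫ θ in η..δ, θ⁻¹ * Real.log (1 / θ) ^ p =
        -G (Real.log (1 / δ)) - -G (Real.log (1 / η)) := by
      refine intervalIntegral.integral_eq_sub_of_hasDerivAt
        (f := fun θ => -G (Real.log (1 / θ))) (fun θ hθ => ?_) hcont.intervalIntegrable
      rw [Set.uIcc_of_le hηδ] at hθ
      have hθ0 : 0 < θ := hη.trans_le hθ.1
      have hd : HasDerivAt (fun θ : ℝ => Real.log (1 / θ)) (-θ⁻¹) θ := by
        simp only [one_div, Real.log_inv]
        exact (Real.hasDerivAt_log hθ0.ne').neg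
      refine ((hG _ (hlog θ hθ0 (hθ.2.trans hδ'))).comp θ hd).neg.congr_deriv ?_
      ring
    have e1 : η * (η⁻¹ * Real.log (1 / η) ^ p) = (Real.log n / 2) ^ p := by
      rw [← mul_assoc, mul_inv_cancel₀ hη.ne', one_mul, hlogη]
    have e2 : (n : ℝ) * η ^ 2 = 1 := by
      rw [hη', ← Real.rpow_natCast, ← Real.rpow_mul hn'.le]
      norm_num
      rw [Real.rpow_neg_one, mul_inv_cancel₀ hn'.ne']
    rw [e1, e2, hint, hlogη] at key
    have := mul_le_mul_of_nonneg_left hn1 hC.le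
    have := mul_le_mul_of_nonneg_left hn2 hC.le
    linarith

lemma log_le_four_mul_log_div_four_add_one {n : ℕ} (hn : 0 < n) :
    Real.log n ≤ 4 * ((Nat.log 2 n / 4 : ℕ) + 1 : ℝ) := by
  have h1 : n < 2 ^ (Nat.log 2 n + 1) := Nat.lt_pow_succ_log_self (by norm_num) n
  have h2 : Nat.log 2 n + 1 ≤ 4 * (Nat.log 2 n / 4 + 1) := by omega
  have h3 : Real.log n ≤ (Nat.log 2 n + 1 : ℕ) * Real.log 2 := by
    rw [← Real.log_pow]
    exact Real.log_le_log (Nat.cast_pos.2 hn) (by exact_mod_cast h1.le)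
  have h4 : ((Nat.log 2 n + 1 : ℕ) : ℝ) ≤ 4 * ((Nat.log 2 n / 4 : ℕ) + 1 : ℝ) := by
    exact_mod_cast h2
  have h5 : Real.log 2 ≤ 1 := by linarith [Real.log_two_lt_d9]
  have h6 : (0 : ℝ) ≤ (Nat.log 2 n + 1 : ℕ) := Nat.cast_nonneg _
  nlinarith

/-- For `p ≤ 0` every term is at least `K^p`; for `p ≥ 0`, Bernoulli's inequality bounds each
increment of `x^{p+1}` by `(p + 1) x^p`. -/
lemma rpow_le_max_mul_sum {p : ℝ} (hp : -1 < p) (K : ℕ) :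
    (K : ℝ) ^ (p + 1) ≤ max 1 (p + 1) * ∑ k ∈ Finset.Icc 1 K, (k : ℝ) ^ p := by
  rcases le_total p 0 with h | h
  · rw [max_eq_left (by linarith), one_mul]
    rcases Nat.eq_zero_or_pos K with rfl | hK
    · simp [Real.zero_rpow (by linarith : p + 1 ≠ 0)]
    · have hK' : (0 : ℝ) < K := Nat.cast_pos.2 hK
      have h1 : ∑ _k ∈ Finset.Icc 1 K, (K : ℝ) ^ p ≤ ∑ k ∈ Finset.Icc 1 K, (k : ℝ) ^ p :=
        Finset.sum_le_sum fun k hk => by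
          have hk' := Finset.mem_Icc.1 hk
          exact Real.rpow_le_rpow_of_nonpos (Nat.cast_pos.2 hk'.1) (by exact_mod_cast hk'.2) h
      refine le_trans (le_of_eq ?_) h1
      rw [Finset.sum_const, Nat.card_Icc, nsmul_eq_mul, Nat.add_sub_cancel, Real.rpow_add hK',
        Real.rpow_one, mul_comm]
  · rw [max_eq_right (by linarith)]
    induction K with
    | zero => simp [Real.zero_rpow (by linarith : p + 1 ≠ 0)]
    | succ K ih =>
      rw [Finset.sum_Icc_succ_top (by omega), mul_add]
      set x : ℝ := ((K + 1 : ℕ) : ℝ) with hx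
      have hx0 : 0 < x := by positivity
      have hxK : (K : ℝ) = x * (1 + -x⁻¹) := by
        rw [mul_add, mul_neg, mul_inv_cancel₀ hx0.ne', hx]
        push_cast
        ring
      have hx1 : x⁻¹ ≤ 1 := inv_le_one_of_one_le₀ (by
        rw [hx]; push_cast; linarith [Nat.cast_nonneg (α := ℝ) K])
      have hB := one_add_mul_self_le_rpow_one_add (s := -x⁻¹) (by linarith) (p := p + 1)
        (by linarith)
      have h1 := mul_le_mul_of_nonneg_left hB (Real.rpow_nonneg hx0.le (p + 1))
      rw [← Real.mul_rpow hx0.le (by linarith), ← hxK] at h1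
      have e : x ^ (p + 1) * (1 + (p + 1) * -x⁻¹) = x ^ (p + 1) - (p + 1) * x ^ p := by
        rw [Real.rpow_add hx0, Real.rpow_one]
        field_simp
        ring
      rw [e] at h1
      linarith

lemma tendsto_log_natCast : Tendsto (fun n : ℕ => Real.log (n : ℝ)) atTop atTop :=
  Real.tendsto_log_atTop.comp tendsto_natCast_atTop_atTop

lemma one_lt_log_of_four_le {n : ℕ} (hn : 4 ≤ n) : 1 < Real.log n := by
  have h1 : Real.log (2 ^ 2) ≤ Real.log n :=
    Real.log_le_log (by norm_num) (by norm_num; exact_mod_cast hn)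
  rw [Real.log_pow] at h1
  push_cast at h1
  linarith [Real.log_two_gt_d9]

lemma hasDeepZeroRate_log_rpow {p : ℝ} (hp : -1 < p) :
    HasDeepZeroRate (fun θ => θ⁻¹ * Real.log (1 / θ) ^ p)
      (fun n => Real.log (n : ℝ) ^ (p + 1)) := by
  have hp1 : 0 < p + 1 := by linarith
  have hhalf : ∀ n : ℕ, 4 ≤ n → (Real.log n / 2) ^ (p + 1) ≤ Real.log n ^ (p + 1) := fun n hn => by
    have := one_lt_log_of_four_le hn
    exact Real.rpow_le_rpow (by linarith) (by linarith) hp1.le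
  refine hasDeepZeroRate_inv_mul_log_rpow (G := fun x => x ^ (p + 1) / (p + 1))
    -- With `K = ⌊log₂ n⌋ / 4`, `log n ≤ 4 (K + 1) ≤ 8 K` as soon as `K ≥ 1`, that is `n ≥ 16`.
    (k₀ := (max 1 (p + 1))⁻¹ * (1 / 8) ^ (p + 1)) (K₀ := max 1 (1 / (p + 1))) (B₀ := 0)
    (fun n hn => Real.rpow_pos_of_pos (by linarith [one_lt_log_of_four_le hn]) _)
    ((tendsto_rpow_atTop hp1).comp tendsto_log_natCast) (fun x hx => ?_) (by positivity) ?_ ?_ ?_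
  · have := (Real.hasDerivAt_rpow_const (x := x) (p := p + 1) (Or.inl hx.ne')).div_const (p + 1)
    refine this.congr_deriv ?_
    rw [add_sub_cancel_right]
    field_simp
  · filter_upwards [eventually_ge_atTop 4, tendsto_log_natCast.eventually_ge_atTop 2] with n hn h2
    have h1 : (Real.log n / 2) ^ p ≤ (Real.log n / 2) ^ (p + 1) :=
      Real.rpow_le_rpow_of_exponent_le (by linarith) (by linarith)
    rw [add_zero]
    refine (h1.trans (hhalf n hn)).trans (le_mul_of_one_le_left ?_ (le_max_left _ _))
    exact Real.rpow_nonneg (by linarith) _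
  · filter_upwards [eventually_ge_atTop 4] with n hn
    rw [add_zero, div_eq_inv_mul, ← one_div]
    have := one_lt_log_of_four_le hn
    exact mul_le_mul (le_max_right _ _) (hhalf n hn) (Real.rpow_nonneg (by linarith) _)
      (by positivity)
  · filter_upwards [eventually_ge_atTop 16] with n hn
    have h0 := one_lt_log_of_four_le (by omega : 4 ≤ n)
    have h1 := log_le_four_mul_log_div_four_add_one (by omega : 0 < n)
    have h2 : 1 ≤ Nat.log 2 n / 4 := by
      have : 4 ≤ Nat.log 2 n := Nat.le_log_of_pow_le (by norm_num) (by omega)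
      omega
    have h2' : (1 : ℝ) ≤ (Nat.log 2 n / 4 : ℕ) := by exact_mod_cast h2
    have h3 := rpow_le_max_mul_sum hp (Nat.log 2 n / 4)
    have h4 : (1 / 8 * Real.log n) ^ (p + 1) ≤ ((Nat.log 2 n / 4 : ℕ) : ℝ) ^ (p + 1) :=
      Real.rpow_le_rpow (by linarith) (by linarith) hp1.le
    rw [Real.mul_rpow (by norm_num) (by linarith)] at h4
    rw [sub_zero, mul_assoc, inv_mul_le_iff₀ (by positivity)]
    exact h4.trans h3

lemma hasDeepZeroRate_log_log :
    HasDeepZeroRate (fun θ => 1 / (θ * Real.log (1 / θ)))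
      (fun n => Real.log (Real.log (n : ℝ))) := by
  have e : (fun θ : ℝ => 1 / (θ * Real.log (1 / θ))) =
      fun θ : ℝ => θ⁻¹ * Real.log (1 / θ) ^ (-1 : ℝ) := by
    ext θ
    rw [Real.rpow_neg_one, one_div, mul_inv]
  rw [e]
  refine hasDeepZeroRate_inv_mul_log_rpow (G := Real.log) (k₀ := 1) (K₀ := 1)
    (B₀ := Real.log 4 + 1)
    (fun n hn => Real.log_pos (one_lt_log_of_four_le hn))
    (Real.tendsto_log_atTop.comp tendsto_log_natCast) (fun x hx => ?_) one_pos ?_ ?_ ?_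
  · rw [Real.rpow_neg_one]
    exact Real.hasDerivAt_log hx.ne'
  · filter_upwards [eventually_ge_atTop 4, tendsto_log_natCast.eventually_ge_atTop 2] with n hn h2
    rw [Real.rpow_neg_one]
    have h3 : (Real.log n / 2)⁻¹ ≤ 1 := inv_le_one_of_one_le₀ (by linarith)
    have h4 := Real.log_pos (one_lt_log_of_four_le hn)
    have h5 : 0 < Real.log 4 := Real.log_pos (by norm_num)
    linarith
  · filter_upwards [eventually_ge_atTop 4] with n hn
    have h1 := one_lt_log_of_four_le hn
    have h2 : Real.log (Real.log n / 2) ≤ Real.log (Real.log n) :=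
      Real.log_le_log (by linarith) (by linarith)
    have h5 : 0 < Real.log 4 := Real.log_pos (by norm_num)
    linarith
  · filter_upwards [eventually_ge_atTop 4] with n hn
    have h0 := one_lt_log_of_four_le hn
    have h1 := log_le_four_mul_log_div_four_add_one (by omega : 0 < n)
    -- For `p = -1` the weights sum to a harmonic number, at least `log (K + 1) ≥ log log n - log
    -- 4`.
    have h2 := log_add_one_le_harmonic (Nat.log 2 n / 4)
    have h3 : ((harmonic (Nat.log 2 n / 4) : ℚ) : ℝ) =
        ∑ k ∈ Finset.Icc 1 (Nat.log 2 n / 4), (k : ℝ) ^ (-1 : ℝ) := by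
      rw [harmonic_eq_sum_Icc]
      push_cast
      simp only [Real.rpow_neg_one]
    rw [h3] at h2
    refine le_trans ?_ h2
    have h4 := Real.log_le_log (by linarith) h1
    rw [Real.log_mul (by norm_num) (by positivity)] at h4
    push_cast
    linarith

theorem mainTheorem10 :
    HasDeepZeroRate (fun θ => 1 / (θ * Real.log (1 / θ)))
      (fun n => Real.log (Real.log (n : ℝ))) ∧
    (∀ p : ℝ, -1 < p →
      HasDeepZeroRate (fun θ => θ⁻¹ * Real.log (1 / θ) ^ p)
        (fun n => Real.log (n : ℝ) ^ (p + 1))) ∧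
    (∀ p : ℝ, 1 < p →
      HasDeepZeroRate (fun θ => θ ^ (-p))
        (fun n => (n : ℝ) ^ ((p - 1) / (p + 1)))) ∧
    (∀ p : ℝ, 0 < p →
      HasDeepZeroRate (fun θ => Real.exp (θ ^ (-p)))
        (fun n => (n : ℝ) * Real.log (n : ℝ) ^ (-2 / p))) :=
  ⟨hasDeepZeroRate_log_log, fun _ hp => hasDeepZeroRate_log_rpow hp,
    fun _ hp => hasDeepZeroRate_rpow hp, fun _ hp => hasDeepZeroRate_exp_rpow hp⟩
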